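/- **Theorem 2.8** ($\mathscr B$ is a Lie algebra; its structure constants). *Notation.* Formal vector fields on $\mathbb R^3$ are the derivations $f\partial_x+g\partial_y+h\partial_z$ with $f,g,h\in\mathbb R[[x,y,z]]$, and $[v,w]=vw-wv$. Let $$\mathrm N=x\partial_y+2y\partial_z,\qquad \mathrm M=z\partial_y+2y\partial_x,\qquad \Delta=xz-y^2,$$ $\kappa_{l,i}=\frac{i!}{(i-l)!}$ and $(a)^k_b=\prod_{j=0}^{k-1}(a+jb)$. For $i,k\in\mathbb N_0$ and $-1\le l\le 2i+1$ let $$\mathrm B^l_{i,k}=\frac{\mathrm{ad}_{\mathrm N}^{\,l+1}\big(z^i\Delta^k\,\mathrm M\big)}{\kappa_{l+1,2i+2}},$$ and read $\mathrm B^l_{i,k}$ as $0$ for all other integers $l,i,k$. Let $\mathscr B$ be the linear span of all formal vector fields $$\mathrm B^1_{0,0}+\sum b^l_{i,k}\,\mathrm B^l_{i,k},\qquad b^l_{i,k}\in\mathbb R,$$ with formal (possibly infinite) sums over all $-1\le l\le 2i+1$, $i,k\in\mathbb N_0$, $(i,k)\ne(0,0)$. For $q=2s+r$ with $r\in\{0,1\}$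 put $$\eta^{q,i}_n=\frac{(-1)^n(s)^n_{-1}(i)^{s+n+r}_{-1}(2i-1)^s_{-2}\,2^{s+n+r}}{n!\,(2i-1)^n_{-2}}\ \text{ if } i\ge s+n+r,\qquad \eta^{q,i}_n=0\ \text{ otherwise}.$$ For $q_1=2s_1+r_1$, $q_2=2s_2+r_2$ with $r_1,r_2\in\{0,1\}$ put $\sigma_2(q_1,q_2,i,j)=q_1+q_2-i-j$, $\rho=|r_2-r_1|$, $\epsilon=\lfloor\frac{r_1+r_2}2\rfloor$, $\tilde\eta^{q_1,q_2}_{n,i,j}=\sum_{r=0}^n\eta^{q_1,i}_r\eta^{q_2,j}_{n-r}$ (so $\tilde\eta^{q_1,q_2}_{-1,i,j}=0$) and, with $\sigma=\sigma_2(q_1,q_2,i,j)$ and $m=s_1+s_2+\epsilon-p-r$ in the summand with index $r$, $$C^{q_1,q_2}_{p,i,j}=\sum_{r=0}^{s_1+s_2+\epsilon-p}\frac{\big(\tilde\eta^{q_1,q_2}_{r,i,j}-\epsilon\,\tilde\eta^{q_1,q_2}_{r-1,i,j}\big)\,(p+1)^m_1\,(p-\sigma+1)^m_1}{\eta^{2p+\rho,\,2p-\sigma+\rho}_0\;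 m!\;2^{-m}\;(4p-2\sigma+3+2\rho)^m_2}.$$ Moreover put $$l^{q_1,q_2}_{1,3,i_1,i_2}=\frac{-(2i_1-q_1+1)(q_2-1)^3_1}{(i_1+1)\kappa_{q_2,2i_2+2}\,\kappa_{q_1+2,2i_1+2}},\quad l^{q_1,q_2}_{2,3,i_1,i_2}=\frac{-2(q_2)^2_1(i_1-q_1)}{(i_1+1)\kappa_{q_2,2i_2+2}\,\kappa_{q_1+1,2i_1+2}},\quad l^{q_1,q_2}_{3,3,i_1,i_2}=\frac{(q_1+1)(q_2+1)}{(i_1+1)\kappa_{q_2,2i_2+2}\,\kappa_{q_1,2i_1+2}},$$ $$l^{q_1,q_2}_{1,2,i_1,i_2}=\frac{-(q_2)^2_1(2i_1-q_1+1)(i_2-q_2)}{(i_1+1)\kappa_{q_2+1,2i_2+2}\,\kappa_{q_1+2,2i_1+2}},\quad l^{q_1,q_2}_{2,2,i_1,i_2}=\frac{-2(q_2+1)(i_1-q_1)(i_2-q_2)}{(i_1+1)\kappa_{q_2+1,2i_2+2}\,\kappa_{q_1+1,2i_1+2}},\quad l^{q_1,q_2}_{3,2,i_1,i_2}=\frac{(q_1+1)(i_2-q_2)}{(i_1+1)\kappa_{q_2+1,2i_2+2}\,\kappa_{q_1,2i_1+2}},$$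 where a constant whose numerator vanishes is $0$, and a product $l\cdot C$ with $l=0$ is $0$. *Theorem.* (a) $\mathscr B$ is a Lie algebra: it is closed under the Lie bracket of formal vector fields. (b) Let $i_1,i_2,k_1,k_2\in\mathbb N_0$, $-1\le q_1\le 2i_1+1$, $-1\le q_2\le 2i_2+1$, $q_1=2s_1+r_1$ and $q_2=2s_2+r_2$ with $r_1,r_2\in\{0,1\}$, $\sigma_1=s_1+s_2+k_1+k_2$ and $\sigma_2=q_1+q_2-i_1-i_2$. Then $$[\mathrm B^{q_1}_{i_1,k_1},\mathrm B^{q_2}_{i_2,k_2}]=\sum_{j=\max\{\sigma_2-1,-1\}}^{s_1+s_2+\lfloor\frac{r_1+r_2}2\rfloor}a^{q_1,q_2}_{j,i_1,i_2}\;\mathrm B^{2j+|r_2-r_1|}_{2j-\sigma_2+|r_2-r_1|,\ \sigma_1-j+\lfloor\frac{r_1+r_2}2\rfloor},$$ where, if $2j+1+|r_2-r_1|\ne0$, $$a^{q_1,q_2}_{j,i_1,i_2}=\frac{(2j+1-\sigma_2+|r_2-r_1|)\,\kappa_{2j+|r_2-r_1|,\,4j-2\sigma_2+2+2|r_2-r_1|}}{2j+|r_2-r_1|+1}\sum_{p=1}^3\Big(l^{q_2,q_1}_{p,3,i_2,i_1}C^{q_2+3-p,\,q_1-3+p}_{j,i_2+1,i_1}-l^{q_1,q_2}_{p,3,i_1,i_2}C^{q_1+3-p,\,q_2-3+p}_{j,i_1+1,i_2}\Big),$$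 and in the remaining case, $j=-1$ and $r_1\ne r_2$, $$a^{q_1,q_2}_{-1,i_1,i_2}=|r_1-r_2|\;\kappa_{0,-2\sigma_2}\sum_{p=1}^3\Big(l^{q_2,q_1}_{p,2,i_2,i_1}C^{q_2+3-p,\,q_1-2+p}_{0,i_2+1,i_1}-l^{q_1,q_2}_{p,2,i_1,i_2}C^{q_1+3-p,\,q_2-2+p}_{0,i_1+1,i_2}\Big).$$ (Coefficients $a^{q_1,q_2}_{j,i_1,i_2}$ in front of a $\mathrm B$ that is read as $0$ are irrelevant.) -/

import Mathlib

open Filter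
open scoped Nat

noncomputable section

namespace TripleZero

/-! ### Formal vector fields in three variables -/

/-- The ring `ℝ[[x, y, z]]` of formal power series; the variables `x, y, z` have the
indices `0, 1, 2`. -/
abbrev FPS : Type := MvPowerSeries (Fin 3) ℝ

/-- Formal vector fields `f ∂/∂x + g ∂/∂y + h ∂/∂z` with `f, g, h ∈ ℝ[[x, y, z]]`, regarded as
differential operators, that is, as the derivations of `ℝ[[x, y, z]]`. Mathlib's Lie bracket on them
is the commutator `⁅v, w⁆ = v w - w v`. -/
abbrev FVF : Type := Derivation ℝ FPS FPS

def x : FPS := MvPowerSeries.X 0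
def y : FPS := MvPowerSeries.X 1
def z : FPS := MvPowerSeries.X 2

/-- `∂/∂x` -/
def dx : FVF := MvPowerSeries.pderiv ℝ 0
/-- `∂/∂y` -/
def dy : FVF := MvPowerSeries.pderiv ℝ 1
/-- `∂/∂z` -/
def dz : FVF := MvPowerSeries.pderiv ℝ 2

/-- `N = x ∂/∂y + 2 y ∂/∂z` -/
def N : FVF := x • dy + (2 * y) • dz

/-- `M = z ∂/∂y + 2 y ∂/∂x` -/
def M : FVF := z • dy + (2 * y) • dx

/-- `Δ = x z - y ^ 2` -/
def Δ : FPS := x * z - y ^ 2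

/-! ### The family `B` and the space it spans -/

/-- `κ_{l,i} = i! / (i - l)!`, where `1 / (i - l)!` is read as `0` for `l > i`. Only nonnegative
`i` occur in a term that matters. -/
def kappa (l i : ℤ) : ℝ :=
  if 0 ≤ i ∧ l ≤ i then ((i.toNat)! : ℝ) / ((i - l).toNat)! else 0

/-- `B^l_{i,k} = (ad_N)^{l+1} (z^i Δ^k M) / κ_{l+1,2i+2}` for `-1 ≤ l ≤ 2i+1` and `i, k ≥ 0`. There
is no vector field `B^l_{i,k}` for other indices; the symbol is then read as `0`. -/
def B (l i k : ℤ) : FVF :=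
  if -1 ≤ l ∧ l ≤ 2 * i + 1 ∧ 0 ≤ i ∧ 0 ≤ k then
    (kappa (l + 1) (2 * i + 2))⁻¹ •
      (LieAlgebra.ad ℝ FVF N ^ (l + 1).toNat) ((z ^ i.toNat * Δ ^ k.toNat) • M)
  else 0

/-- The index triples `(l, i, k)` of the nonlinear members of the family: `B^l_{i,k}` is homogeneous
of degree `i + 2k + 1`, so it is nonlinear exactly if `(i, k) ≠ (0, 0)`. -/
structure NonlinearIndex where
  l : ℤ
  i : ℕ
  k : ℕ
  neg_one_le : -1 ≤ l
  le_two_mul : l ≤ 2 * i + 1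
  nonlinear : i ≠ 0 ∨ k ≠ 0

/-- `v` is the formal sum of the family `f`: for each component and each monomial, the coefficients
of all sufficiently large finite partial sums agree with the one of `v`. -/
def IsFormalSum {ι : Type} (f : ι → FVF) (v : FVF) : Prop :=
  ∀ (a : Fin 3) (d : Fin 3 →₀ ℕ), ∀ᶠ S : Finset ι in atTop,
    MvPowerSeries.coeff d ((∑ t ∈ S, f t) (MvPowerSeries.X a)) =
      MvPowerSeries.coeff d (v (MvPowerSeries.X a))

/-- The space `𝓑`, the linear span of all vector fields `B^1_{0,0} + ∑ b^l_{i,k} B^l_{i,k}`, where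
the sum is a formal sum of nonlinear members of the family with arbitrary real coefficients. -/
def scriptB : Submodule ℝ FVF :=
  Submodule.span ℝ {v | ∃ b : NonlinearIndex → ℝ, ∃ w : FVF,
    IsFormalSum (fun t => b t • B t.l t.i t.k) w ∧ v = B 1 0 0 + w}

/-! ### The structure constants -/

/-- `σ₁(s₁, s₂, k₁, k₂) = s₁ + s₂ + k₁ + k₂` -/
def sigma1 (s₁ s₂ k₁ k₂ : ℤ) : ℤ := s₁ + s₂ + k₁ + k₂

/-- `σ₂(q₁, q₂, i₁, i₂) = q₁ + q₂ - i₁ - i₂` -/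
def sigma2 (q₁ q₂ i₁ i₂ : ℤ) : ℤ := q₁ + q₂ - i₁ - i₂

/-- `(a)^k_b = ∏_{j=0}^{k-1} (a + j b)` -/
def poch (a b : ℝ) (k : ℕ) : ℝ := ∏ j ∈ Finset.range k, (a + j * b)

/-- The constant `η^{q,i}_n`, where `q = 2 s + r` with `r ∈ {0, 1}`. It is used for `q, n ≥ 0`. -/
def eta (q i n : ℤ) : ℝ :=
  let s := q / 2
  let r := q % 2
  if s + n + r ≤ i then
    ((-1) ^ n.toNat * poch s (-1) n.toNat * poch i (-1) (s + n + r).toNat *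
        poch (2 * i - 1) (-2) s.toNat * 2 ^ (s + n + r).toNat) /
      ((n.toNat)! * poch (2 * i - 1) (-2) n.toNat)
  else 0

/-- `η̃^{q₁,q₂}_{n,i,j} = ∑_{r=0}^n η^{q₁,i}_r η^{q₂,j}_{n-r}`, which is `0` for `n = -1`. -/
def etaTilde (q₁ q₂ n i j : ℤ) : ℝ :=
  ∑ r ∈ Finset.Icc 0 n, eta q₁ i r * eta q₂ j (n - r)

/-- The constant `C^{q₁,q₂}_{p,i,j}`, where `q₁ = 2 s₁ + r₁` and `q₂ = 2 s₂ + r₂` with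
`r₁, r₂ ∈ {0, 1}`. -/
def C (q₁ q₂ p i j : ℤ) : ℝ :=
  let s₁ := q₁ / 2
  let r₁ := q₁ % 2
  let s₂ := q₂ / 2
  let r₂ := q₂ % 2
  let f := (r₁ + r₂) / 2
  let σ := sigma2 q₁ q₂ i j
  ∑ r ∈ Finset.Icc 0 (s₁ + s₂ + f - p),
    (etaTilde q₁ q₂ r i j - f * etaTilde q₁ q₂ (r - 1) i j) *
        poch (p + 1) 1 (s₁ + s₂ - p - r + f).toNat *
        poch (p - σ + 1) 1 (s₁ + s₂ - p - r + f).toNat /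
      (eta (2 * p + |r₂ - r₁|) (2 * p - σ + |r₂ - r₁|) 0 *
        ((s₁ + s₂ - p - r + f).toNat)! *
        (2 : ℝ) ^ (p + r - (s₁ + s₂ + f)) *
        poch (4 * p - 2 * σ + 3 + 2 * |r₂ - r₁|) 2 (s₁ + s₂ - p - r + f).toNat)

/-- `l^{q₁,q₂}_{p,3,i₁,i₂}` for `p = 1, 2, 3` -/
def lThree (p : ℕ) (q₁ q₂ i₁ i₂ : ℤ) : ℝ :=
  match p with
  | 1 => -(2 * i₁ - q₁ + 1) * poch (q₂ - 1) 1 3 /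
      ((i₁ + 1) * kappa q₂ (2 * i₂ + 2) * kappa (q₁ + 2) (2 * i₁ + 2))
  | 2 => -2 * poch q₂ 1 2 * (i₁ - q₁) /
      ((i₁ + 1) * kappa q₂ (2 * i₂ + 2) * kappa (q₁ + 1) (2 * i₁ + 2))
  | 3 => (q₁ + 1) * (q₂ + 1) /
      ((i₁ + 1) * kappa q₂ (2 * i₂ + 2) * kappa q₁ (2 * i₁ + 2))
  | _ => 0

/-- `l^{q₁,q₂}_{p,2,i₁,i₂}` for `p = 1, 2, 3` -/
def lTwo (p : ℕ) (q₁ q₂ i₁ i₂ : ℤ) : ℝ :=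
  match p with
  | 1 => -poch q₂ 1 2 * (2 * i₁ - q₁ + 1) * (i₂ - q₂) /
      ((i₁ + 1) * kappa (q₂ + 1) (2 * i₂ + 2) * kappa (q₁ + 2) (2 * i₁ + 2))
  | 2 => -2 * (q₂ + 1) * (i₁ - q₁) * (i₂ - q₂) /
      ((i₁ + 1) * kappa (q₂ + 1) (2 * i₂ + 2) * kappa (q₁ + 1) (2 * i₁ + 2))
  | 3 => (q₁ + 1) * (i₂ - q₂) /
      ((i₁ + 1) * kappa (q₂ + 1) (2 * i₂ + 2) * kappa q₁ (2 * i₁ + 2))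
  | _ => 0

/-- The structure constant `a^{q₁,q₂}_{j,i₁,i₂}`, where `q₁ = 2 s₁ + r₁` and `q₂ = 2 s₂ + r₂` with
`r₁, r₂ ∈ {0, 1}`. The second case is the case `j = -1`, `r₁ ≠ r₂`. A summand whose factor
`l^{q₁,q₂}_{p,·,i₁,i₂}` vanishes is `0`; all summands in which a superscript of `C` is negative are
of this kind. -/
def a (q₁ q₂ j i₁ i₂ : ℤ) : ℝ :=
  let r₁ := q₁ % 2
  let r₂ := q₂ % 2
  let σ := sigma2 q₁ q₂ i₁ i₂
  if 2 * j + 1 + |r₂ - r₁| ≠ 0 then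
    (∑ p ∈ Finset.Icc 1 3,
        (lThree p q₂ q₁ i₂ i₁ * C (q₂ + 3 - p) (q₁ - 3 + p) j (i₂ + 1) i₁ -
          lThree p q₁ q₂ i₁ i₂ * C (q₁ + 3 - p) (q₂ - 3 + p) j (i₁ + 1) i₂)) *
      (2 * j + 1 - σ + |r₂ - r₁|) *
      kappa (2 * j + |r₂ - r₁|) (4 * j - 2 * σ + 2 + 2 * |r₂ - r₁|) /
      (2 * j + |r₂ - r₁| + 1)
  else
    |r₁ - r₂| *
      (∑ p ∈ Finset.Icc 1 3,
        (lTwo p q₂ q₁ i₂ i₁ * C (q₂ + 3 - p) (q₁ - 2 + p) 0 (i₂ + 1) i₁ -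
          lTwo p q₁ q₂ i₁ i₂ * C (q₁ + 3 - p) (q₂ - 2 + p) 0 (i₁ + 1) i₂)) *
      kappa 0 (-2 * σ)

end TripleZero

end

/-! The fields `N`, `M` and `H = [N, M]` span a copy of sl₂ and annihilate Δ. The field `ham f` is
the cross product ∇f × ∇Δ, so {f, g} = `ham f g` is a Poisson bracket with Casimir Δ, and `ham`
turns Poisson brackets into Lie brackets (`lie_ham_ham`). Since `ham` intertwines `N` with ad_N and
sends z^(i+1) Δ^k to (i+1) z^i Δ^k M, each B^l_{i,k} is a scalar multiple of the Hamiltonian field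
of the weight vector N^(l+1)(z^(i+1)) Δ^k (`ham_EE`).

A bracket of two members is therefore `ham` of a Poisson bracket of weight vectors, which is a
combination of products of two weight vectors (`ham_EE_apply`). Such products are expanded by an
explicit Clebsch-Gordan formula (`EE_mul_EE`). It arises by writing weight vectors in monomials x^a
y^r z^c Δ^n with r ≤ 1 (`E_expansion`, the constants η), multiplying and reducing y² = xz - Δ (the
constants η̃ and the ε-correction), and writing monomials in weight vectors again
(`monomial_expansion`); the composite coefficients are the constants C. Hence the bracket is some
combination of members of the family (`exists_lie_B_eq_sum`).

The stated coefficients come from one component of this identity: the z-component, or the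
y-component for B^{-1}, whose z-component is zero. Weight vectors with distinct powers of `N` are
linearly independent (`EE_linearIndependent`), so the coefficients may be compared (`lie_B_eq_sum`).

For (a), B^l_{i,k} is homogeneous of degree i + 2k + 1 and i + 2k is additive under brackets. The
formal sums of nonlinear members form the closure of their span in the filtration by order, and the
bracket respects this filtration. The space 𝓑 is the line through B^1_{0,0} = -N plus this closure
(`scriptB_eq`), which makes it closed under brackets. -/

noncomputable section

namespace TripleZero

/-! ### Derivations of the power series ring are determined by their values on the variables -/

open MvPowerSeries in
/-- A power series without constant term is a combination of the variables. -/
theorem exists_eq_C_add_sum_X_mul (f : FPS) :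
    ∃ (r : ℝ) (g : Fin 3 → FPS), f = MvPowerSeries.C r + ∑ b, MvPowerSeries.X b * g b := by
  classical
  -- Each nonconstant monomial is assigned to the first variable that divides it, so the three parts
  -- have disjoint supports.
  let part : Fin 3 → FPS := fun b d => if d b ≠ 0 ∧ ∀ c < b, d c = 0 then coeff d f else 0
  have hpart : ∀ b d, coeff d (part b) = if d b ≠ 0 ∧ ∀ c < b, d c = 0 then coeff d f else 0 :=
    fun b d => rfl
  have hdvd : ∀ b, (X b : FPS) ∣ part b := by
    intro b
    rw [X_dvd_iff]
    intro m hm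
    rw [hpart, if_neg]
    simp [hm]
  choose g hg using hdvd
  refine ⟨coeff 0 f, g, ?_⟩
  ext d
  simp only [← hg, map_add, hpart, coeff_C, Fin.sum_univ_three]
  by_cases h0 : d 0 = 0
  · by_cases h1 : d 1 = 0
    · by_cases h2 : d 2 = 0
      · have : d = 0 := by ext b; fin_cases b <;> simp [h0, h1, h2]
        subst this; simp
      · have : d ≠ 0 := by rintro rfl; simp at h2
        have hlt : ∀ c < (2 : Fin 3), d c = 0 := by
          intro c hc; fin_cases c <;> simp_all
        rw [if_neg this, if_neg (by simp [h0]), if_neg (by simp [h1]), if_pos ⟨h2, hlt⟩]; simp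
    · have : d ≠ 0 := by rintro rfl; simp at h1
      have hlt : ∀ c < (1 : Fin 3), d c = 0 := by
        intro c hc; fin_cases c <;> simp_all
      have hn : ¬ ∀ c < (2 : Fin 3), d c = 0 := fun h => h1 (h 1 (by decide))
      simp [h0, h1, this, hlt, hn]
  · have : d ≠ 0 := by rintro rfl; simp at h0
    have hn : ¬ ∀ c < (2 : Fin 3), d c = 0 := fun h => h0 (h 0 (by decide))
    have hn' : ¬ ∀ c < (1 : Fin 3), d c = 0 := fun h => h0 (h 0 (by decide))
    simp [h0, this, hn, hn']

theorem le_order_sum {ι : Type*} (s : Finset ι) (f : ι → FPS) (n : ℕ∞)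
    (h : ∀ i ∈ s, n ≤ (f i).order) : n ≤ (∑ i ∈ s, f i).order := by
  classical
  induction s using Finset.induction_on with
  | empty => simp
  | insert i s hi ih =>
    rw [Finset.sum_insert hi]
    exact (le_min (h i (Finset.mem_insert_self i s))
      (ih fun j hj => h j (Finset.mem_insert_of_mem hj))).trans MvPowerSeries.min_order_le_add

theorem one_le_order_X (b : Fin 3) : 1 ≤ (MvPowerSeries.X b : FPS).order := by
  rw [MvPowerSeries.one_le_order_iff_constCoeff_eq_zero]; simp

/-- No continuity of D is assumed. If f = r + ∑ X_b g_b, then D f = ∑ X_b D(g_b), so a lower bound n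
for the order of every D g improves to n + 1; all orders are infinite. -/
theorem derivation_eq_zero (D : FVF) (h : ∀ b, D (MvPowerSeries.X b) = 0) : D = 0 := by
  have key : ∀ (n : ℕ) (f : FPS), (n : ℕ∞) ≤ (D f).order := by
    intro n
    induction n with
    | zero => simp
    | succ n ih =>
      intro f
      obtain ⟨r, g, rfl⟩ := exists_eq_C_add_sum_X_mul f
      have hC : D (MvPowerSeries.C r) = 0 := D.map_algebraMap r
      rw [map_add, hC, zero_add, map_sum]
      refine le_order_sum _ _ _ fun b _ => ?_
      rw [Derivation.leibniz, h, smul_zero, add_zero, smul_eq_mul]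
      refine le_trans ?_ MvPowerSeries.le_order_mul
      push_cast
      rw [add_comm]
      exact add_le_add (one_le_order_X b) (ih _)
  ext1 f
  have : (D f).order = ⊤ := ENat.eq_top_iff_forall_ge.2 fun n => key n f
  simpa using this

@[simp] theorem dx_x : dx x = 1 := MvPowerSeries.pderiv_X_self
@[simp] theorem dx_y : dx y = 0 := MvPowerSeries.pderiv_X_of_ne (by decide)
@[simp] theorem dx_z : dx z = 0 := MvPowerSeries.pderiv_X_of_ne (by decide)
@[simp] theorem dy_x : dy x = 0 := MvPowerSeries.pderiv_X_of_ne (by decide)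
@[simp] theorem dy_y : dy y = 1 := MvPowerSeries.pderiv_X_self
@[simp] theorem dy_z : dy z = 0 := MvPowerSeries.pderiv_X_of_ne (by decide)
@[simp] theorem dz_x : dz x = 0 := MvPowerSeries.pderiv_X_of_ne (by decide)
@[simp] theorem dz_y : dz y = 0 := MvPowerSeries.pderiv_X_of_ne (by decide)
@[simp] theorem dz_z : dz z = 1 := MvPowerSeries.pderiv_X_self

@[ext] theorem FVF.ext {v w : FVF} (hx : v x = w x) (hy : v y = w y) (hz : v z = w z) : v = w := by
  rw [← sub_eq_zero]
  refine derivation_eq_zero _ fun b => ?_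
  fin_cases b
  · exact sub_eq_zero.2 hx
  · exact sub_eq_zero.2 hy
  · exact sub_eq_zero.2 hz

theorem FVF.apply_eq (v : FVF) (f : FPS) : v f = v x * dx f + v y * dy f + v z * dz f := by
  have : v = v x • dx + v y • dy + v z • dz := by
    ext1 <;> simp
  conv_lhs => rw [this]
  simp

@[simp] theorem FVF.apply_two (v : FVF) : v 2 = 0 := v.map_natCast 2

/-! ### The sl₂-triple and its invariant Δ -/

/-- The semisimple element of the `sl₂`-triple containing `N` and `M`. -/
def H : FVF := (2 * x) • dx - (2 * z) • dz

@[simp] theorem N_x : N x = 0 := by simp [N]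
@[simp] theorem N_y : N y = x := by simp [N]
@[simp] theorem N_z : N z = 2 * y := by simp [N]
@[simp] theorem M_x : M x = 2 * y := by simp [M]
@[simp] theorem M_y : M y = z := by simp [M]
@[simp] theorem M_z : M z = 0 := by simp [M]
@[simp] theorem H_x : H x = 2 * x := by simp [H]
@[simp] theorem H_y : H y = 0 := by simp [H]
@[simp] theorem H_z : H z = -(2 * z) := by simp [H]

theorem N_Δ : N Δ = 0 := by simp [Δ, pow_two]; ring
theorem M_Δ : M Δ = 0 := by simp [Δ, pow_two]; ring
theorem H_Δ : H Δ = 0 := by simp [Δ, pow_two]; ring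

theorem lie_N_M : ⁅N, M⁆ = H := by
  ext1 <;> simp [Derivation.commutator_apply] 
theorem lie_N_H : ⁅N, H⁆ = -(2 : ℝ) • N := by
  ext1 <;> simp [Derivation.commutator_apply, two_smul] <;> ring
theorem lie_M_H : ⁅M, H⁆ = (2 : ℝ) • M := by
  ext1 <;> simp [Derivation.commutator_apply, two_smul] <;> ring

theorem N_M_apply (f : FPS) : N (M f) = M (N f) + H f := by
  rw [← lie_N_M, Derivation.commutator_apply]; ring
theorem N_H_apply (f : FPS) : N (H f) = H (N f) - (2 : ℝ) • N f := by
  have := congrArg (fun v : FVF => v f) lie_N_H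
  simp only [Derivation.commutator_apply, Derivation.smul_apply] at this
  rw [sub_eq_iff_eq_add] at this
  rw [this]; module
theorem M_H_apply (f : FPS) : M (H f) = H (M f) + (2 : ℝ) • M f := by
  have := congrArg (fun v : FVF => v f) lie_M_H
  simp only [Derivation.commutator_apply, Derivation.smul_apply] at this
  rw [sub_eq_iff_eq_add] at this
  rw [this]; module

/-! ### Hamiltonian vector fields and the Poisson bracket -/

/-- The Hamiltonian vector field of `f` for the Poisson structure with Casimir `Δ`. -/
def ham (f : FPS) : FVF := N f • dx - ((1 / 2 : ℝ) • H f) • dy - M f • dz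

@[simp] theorem ham_x (f : FPS) : ham f x = N f := by simp [ham]
@[simp] theorem ham_y (f : FPS) : ham f y = -((1 / 2 : ℝ) • H f) := by simp [ham]
@[simp] theorem ham_z (f : FPS) : ham f z = -M f := by simp [ham]

theorem ham_add (f g : FPS) : ham (f + g) = ham f + ham g := by
  ext1 <;> simp <;> module
theorem ham_smul (r : ℝ) (f : FPS) : ham (r • f) = r • ham f := by
  ext1 <;> simp
  module

/-- `ham` as a linear map. -/
def hamₗ : FPS →ₗ[ℝ] FVF where
  toFun := ham
  map_add' := ham_add
  map_smul' := ham_smul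

theorem ham_sum {ι : Type*} (s : Finset ι) (f : ι → FPS) :
    ham (∑ i ∈ s, f i) = ∑ i ∈ s, ham (f i) := map_sum hamₗ f s

theorem ham_zero : ham 0 = 0 := map_zero hamₗ

theorem ham_mul_Δ_pow (f : FPS) (k : ℕ) : ham (f * Δ ^ k) = Δ ^ k • ham f := by
  ext1 <;> simp [Derivation.leibniz_pow, N_Δ, M_Δ, H_Δ]

theorem two_smul_half (f : FPS) : (2 : FPS) * ((1 / 2 : ℝ) • f) = f := by
  rw [two_mul]; module

/-- In partial derivatives `ham f g` is the determinant of the gradients of f, Δ and g, which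
changes sign when f and g are exchanged. -/
theorem ham_apply_antisymm (f g : FPS) : ham f g = -ham g f := by
  rw [FVF.apply_eq (ham f) g, FVF.apply_eq (ham g) f]
  have h2 : ∀ f : FPS, (1 / 2 : ℝ) • H f = x * dx f - z * dz f := by
    intro f
    have : H f = (2 : ℝ) • (x * dx f - z * dz f) := by
      simp [H, two_smul]; ring
    rw [this, smul_smul]; norm_num
  simp only [ham_x, ham_y, ham_z, h2, N, M, Derivation.add_apply, Derivation.smul_apply, smul_eq_mul]
  ring

/-- The fields N, M, H are themselves Hamiltonian, with functions -x, z, 2y. This identity and its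
analogues for M and H are thus the cases of the Jacobi identity with one coordinate argument;
`lie_ham_ham` is reduced to them. -/
theorem lie_N_ham (f : FPS) : ⁅N, ham f⁆ = ham (N f) := by
  ext1
  · simp [Derivation.commutator_apply]
  · simp only [Derivation.commutator_apply, ham_y, N_y, ham_x, map_neg, Derivation.map_smul, N_H_apply]
    module
  · simp only [Derivation.commutator_apply, ham_y, N_z, ham_z, map_neg, N_M_apply,
      Derivation.leibniz, smul_eq_mul, FVF.apply_two, mul_zero, add_zero]
    rw [mul_neg, two_smul_half]; ring

theorem lie_M_ham (f : FPS) : ⁅M, ham f⁆ = ham (M f) := by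
  ext1
  · simp only [Derivation.commutator_apply, ham_y, M_x, ham_x, map_neg, N_M_apply,
      Derivation.leibniz, smul_eq_mul, FVF.apply_two, mul_zero, add_zero]
    rw [mul_neg, two_smul_half]; ring
  · simp only [Derivation.commutator_apply, ham_y, M_y, ham_z, map_neg, Derivation.map_smul, M_H_apply]
    module
  · simp [Derivation.commutator_apply]

theorem lie_H_ham (f : FPS) : ⁅H, ham f⁆ = ham (H f) := by
  have hl : ⁅⁅N, M⁆, ham f⁆ = ⁅N, ⁅M, ham f⁆⁆ - ⁅M, ⁅N, ham f⁆⁆ := lie_lie N M (ham f)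
  rw [← lie_N_M, hl, lie_M_ham, lie_N_ham, lie_N_ham, lie_M_ham, ← sub_eq_zero]
  have h : ∀ f g : FPS, ham (f - g) = ham f - ham g := fun f g => map_sub hamₗ f g
  rw [Derivation.commutator_apply, h]; abel

/-- It suffices to compare values on x, y, z, where `ham g` takes the values v g up to a scalar,
with v = N, H, M. The claim then says that v is a derivation of the Poisson bracket, which is [v,
ham f] = ham (v f) combined with skew symmetry. -/
theorem lie_ham_ham (f g : FPS) : ⁅ham f, ham g⁆ = ham (ham f g) := by
  have key : ∀ v : FVF, (∀ f, ⁅v, ham f⁆ = ham (v f)) →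
      ham f (v g) - ham g (v f) = v (ham f g) := by
    intro v hv
    have := congrArg (fun w : FVF => w g) (hv f)
    simp only [Derivation.commutator_apply] at this
    rw [ham_apply_antisymm (v f) g] at this
    rw [sub_eq_iff_eq_add] at this
    rw [this]; ring
  ext1
  · simpa [Derivation.commutator_apply] using key N lie_N_ham
  · have := key H lie_H_ham
    simp only [Derivation.commutator_apply, ham_y, map_neg, Derivation.map_smul, ← this]
    module
  · have := key M lie_M_ham
    simp only [Derivation.commutator_apply, ham_z, map_neg, ← this]
    ring

/-! ### Weight vectors: action of sl₂, partial derivatives, multiplication by x -/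

/-- The weight vector `N ^ n (z ^ i)`. -/
def E (n i : ℕ) : FPS := (N : FPS → FPS)^[n] (z ^ i)

@[simp] theorem E_zero (i : ℕ) : E 0 i = z ^ i := rfl

theorem N_E (n i : ℕ) : N (E n i) = E (n + 1) i := (Function.iterate_succ_apply' _ _ _).symm

theorem derivation_z_pow (v : FVF) (i : ℕ) :
    v (z ^ (i + 1)) = ((i + 1 : ℕ) : ℝ) • (z ^ i * v z) := by
  rw [Derivation.leibniz_pow, Nat.cast_smul_eq_nsmul]
  simp

theorem H_E (n i : ℕ) : H (E n i) = (2 * n - 2 * i : ℝ) • E n i := by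
  induction n with
  | zero =>
    cases i with
    | zero => simp
    | succ i =>
      rw [E_zero, derivation_z_pow, H_z]
      have : z ^ i * -(2 * z) = (-2 : ℝ) • z ^ (i + 1) := by
        rw [neg_smul, two_smul]; ring
      rw [this, smul_smul]; congr 1; push_cast; ring
  | succ n ih =>
    rw [← N_E, sub_eq_iff_eq_add.1 (N_H_apply _).symm, ih, Derivation.map_smul, ← add_smul]
    congr 1; push_cast; ring

theorem M_E_zero (i : ℕ) : M (E 0 i) = 0 := by
  simp [Derivation.leibniz_pow]

theorem M_E_succ (n i : ℕ) : M (E (n + 1) i) = ((n + 1) * (2 * i - n) : ℝ) • E n i := by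
  induction n with
  | zero =>
    rw [← N_E, ← sub_eq_iff_eq_add.2 (N_M_apply _), M_E_zero, H_E, map_zero, zero_sub, ← neg_smul]
    congr 1; push_cast; ring
  | succ n ih =>
    rw [← N_E, ← sub_eq_iff_eq_add.2 (N_M_apply _), ih, H_E, Derivation.map_smul, N_E, ← sub_smul]
    congr 1; push_cast; ring

/-- ∂z commutes with N, while [∂y, N] = 2 ∂z and [∂x, N] = ∂y. The partial derivatives of N^n(z^i)
are therefore found in the order z, y, x, each by induction on n. -/
theorem dz_E (n i : ℕ) : dz (E n (i + 1)) = (i + 1 : ℝ) • E n i := by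
  have hc : ∀ f, dz (N f) = N (dz f) := by
    intro f
    have h : ⁅dz, N⁆ = 0 := by ext1 <;> simp [Derivation.commutator_apply]
    have := congrArg (fun v : FVF => v f) h
    simpa [Derivation.commutator_apply, sub_eq_zero] using this
  induction n with
  | zero => rw [E_zero, derivation_z_pow, dz_z, mul_one, E_zero]; push_cast; rfl
  | succ n ih => rw [← N_E, hc, ih, Derivation.map_smul, N_E]

theorem dy_N (f : FPS) : dy (N f) = N (dy f) + (2 : ℝ) • dz f := by
  have h : ⁅dy, N⁆ = (2 : ℝ) • dz := by
    ext1 <;> simp [Derivation.commutator_apply, two_smul, one_add_one_eq_two]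
  have := congrArg (fun v : FVF => v f) h
  simp only [Derivation.commutator_apply, Derivation.smul_apply] at this
  rw [← this]; ring

theorem dx_N (f : FPS) : dx (N f) = N (dx f) + dy f := by
  have h : ⁅dx, N⁆ = dy := by ext1 <;> simp [Derivation.commutator_apply]
  have := congrArg (fun v : FVF => v f) h
  simp only [Derivation.commutator_apply] at this
  rw [← this]; ring

theorem dy_E_zero (i : ℕ) : dy (E 0 i) = 0 := by simp [Derivation.leibniz_pow]
theorem dx_E_zero (i : ℕ) : dx (E 0 i) = 0 := by simp [Derivation.leibniz_pow]

theorem dy_E_succ (n i : ℕ) :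
    dy (E (n + 1) (i + 1)) = (2 * (n + 1) * (i + 1) : ℝ) • E n i := by
  induction n with
  | zero =>
    rw [← N_E, dy_N, dy_E_zero, dz_E, map_zero, zero_add, smul_smul]
    congr 1; push_cast; ring
  | succ n ih =>
    rw [← N_E, dy_N, ih, dz_E, Derivation.map_smul, N_E, smul_smul, ← add_smul]
    congr 1; push_cast; ring

theorem dx_E_one (i : ℕ) : dx (E 1 i) = 0 := by
  rw [← N_E, dx_N, dx_E_zero, dy_E_zero]; simp

theorem dx_E_succ_succ (n i : ℕ) :
    dx (E (n + 2) (i + 1)) = ((n + 2) * (n + 1) * (i + 1) : ℝ) • E n i := by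
  induction n with
  | zero =>
    rw [← N_E, dx_N, dx_E_one, dy_E_succ, map_zero, zero_add]
    congr 1; push_cast; ring
  | succ n ih =>
    rw [← N_E, dx_N, ih, dy_E_succ, Derivation.map_smul, N_E, ← add_smul]
    congr 1; push_cast; ring

theorem N_mul_Δ_pow (f : FPS) (k : ℕ) : N (f * Δ ^ k) = N f * Δ ^ k := by
  simp [Derivation.leibniz_pow, N_Δ, mul_comm]
theorem M_mul_Δ_pow (f : FPS) (k : ℕ) : M (f * Δ ^ k) = M f * Δ ^ k := by
  simp [Derivation.leibniz_pow, M_Δ, mul_comm]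
theorem H_mul_Δ_pow (f : FPS) (k : ℕ) : H (f * Δ ^ k) = H f * Δ ^ k := by
  simp [Derivation.leibniz_pow, H_Δ, mul_comm]

/-- N²(z^(i+2)) is a combination of x z^(i+1) and y² z^i, and y² = xz - Δ. Since N annihilates x and
Δ, applying N repeatedly then gives the general formula `x_mul_E`. -/
theorem x_mul_z_pow (i : ℕ) : (2 * (i + 2) * (2 * i + 3) : ℝ) • (x * z ^ (i + 1)) =
    E 2 (i + 2) + (4 * (i + 1) * (i + 2) : ℝ) • (Δ * z ^ i) := by
  rw [← N_E, ← N_E, E_zero, derivation_z_pow, Derivation.map_smul, Derivation.leibniz,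
    derivation_z_pow]
  simp only [N_z, Derivation.leibniz, FVF.apply_two, N_y, Δ]
  have h2 : (2 : FPS) = (2 : ℝ) • (1 : FPS) := by rw [two_smul]; ring
  rw [h2]
  simp only [smul_eq_mul, mul_zero, add_zero, smul_mul_assoc, one_mul, mul_smul_comm, sub_mul,
    smul_sub, smul_add, smul_smul]
  have e1 : z ^ (i + 1) * x = x * z ^ (i + 1) := by ring
  have e2 : y * (z ^ i * y) = y ^ 2 * z ^ i := by ring
  have e3 : x * z * z ^ i = x * z ^ (i + 1) := by ring
  rw [e1, e2, e3]
  push_cast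
  module

/-- Multiplication by `x` on weight vectors. -/
theorem x_mul_E (n i : ℕ) : (2 * (i + 2) * (2 * i + 3) : ℝ) • (x * E n (i + 1)) =
    E (n + 2) (i + 2) + (4 * (i + 1) * (i + 2) : ℝ) • (Δ * E n i) := by
  induction n with
  | zero => exact x_mul_z_pow i
  | succ n ih =>
    have := congrArg N ih
    simpa [N_E, N_Δ] using this

theorem x_mul_E_zero (n : ℕ) : (2 : ℝ) • (x * E n 0) = E (n + 2) 1 := by
  induction n with
  | zero => 
    rw [← N_E, ← N_E]; simp [two_smul]; ring
  | succ n ih =>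
    have := congrArg N ih
    simpa [N_E] using this

/-- Multiplication by x expresses E (n+2) (i+2) through E n (i+1) and E n i, and both are again out
of range; so induction on i applies with step two. -/
theorem E_eq_zero {n i : ℕ} (h : 2 * i < n) : E n i = 0 := by
  induction i using Nat.strong_induction_on generalizing n with
  | _ i ih =>
    match i, ih with
    | 0, _ =>
      obtain ⟨n, rfl⟩ : ∃ m, n = m + 1 := ⟨n - 1, by omega⟩
      clear h
      induction n with
      | zero => rw [← N_E]; simp
      | succ n ih => rw [← N_E, ih, map_zero]
    | 1, ih =>
      obtain ⟨n, rfl⟩ : ∃ m, n = m + 2 := ⟨n - 2, by omega⟩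
      rw [← x_mul_E_zero, ih 0 (by omega) (by omega)]; simp
    | i + 2, ih =>
      obtain ⟨n, rfl⟩ : ∃ m, n = m + 2 := ⟨n - 2, by omega⟩
      have := x_mul_E n i
      rw [ih (i + 1) (by omega) (by omega), ih i (by omega) (by omega)] at this
      simpa using this.symm

/-! ### Weight vectors with integral indices -/

/-- `N ^ q (z ^ i) * Δ ^ k`, read as `0` outside of the range `0 ≤ q ≤ 2 i`, `0 ≤ k`. -/
def EE (q i k : ℤ) : FPS :=
  if 0 ≤ q ∧ q ≤ 2 * i ∧ 0 ≤ k then E q.toNat i.toNat * Δ ^ k.toNat else 0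

theorem EE_of_neg {q : ℤ} (h : q < 0) (i k : ℤ) : EE q i k = 0 := if_neg (by omega)
theorem EE_of_lt {q i : ℤ} (h : 2 * i < q) (k : ℤ) : EE q i k = 0 := if_neg (by omega)

theorem EE_natCast (q i k : ℕ) : EE q i k = E q i * Δ ^ k := by
  unfold EE
  split_ifs with h
  · simp
  · rw [E_eq_zero (by omega), zero_mul]

/-- To prove an identity it suffices to treat natural indices. -/
theorem EE_cases {P : ℤ → ℤ → ℤ → Prop} (q i k : ℤ)
    (h : ∀ q i k : ℕ, q ≤ 2 * i → P q i k)
    (h₀ : q < 0 ∨ 2 * i < q ∨ k < 0 → P q i k) : P q i k := by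
  by_cases hq : q < 0 ∨ 2 * i < q ∨ k < 0
  · exact h₀ hq
  · push Not at hq
    lift q to ℕ using by omega
    lift i to ℕ using by omega
    lift k to ℕ using by omega
    exact h q i k (by omega)

/-- The case q = -1 has to be excluded: there the left side is zero by convention, while the right
side can be z^i Δ^k. -/
theorem N_EE {q : ℤ} (hq : 0 ≤ q) (i k : ℤ) : N (EE q i k) = EE (q + 1) i k := by
  revert hq
  refine EE_cases (P := fun q i k => 0 ≤ q → N (EE q i k) = EE (q + 1) i k) q i k ?_ ?_
  · intro q i k _ _
    have := EE_natCast (q + 1) i k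
    push_cast at this
    rw [this, EE_natCast, N_mul_Δ_pow, N_E]
  · intro h hq
    unfold EE
    rw [if_neg (by omega), if_neg (by omega), map_zero]

theorem M_EE (q i k : ℤ) : M (EE q i k) = (q * (2 * i - q + 1) : ℝ) • EE (q - 1) i k := by
  refine EE_cases
    (P := fun q i k => M (EE q i k) = (q * (2 * i - q + 1) : ℝ) • EE (q - 1) i k) q i k ?_ ?_
  · intro q i k _
    cases q with
    | zero =>
      rw [EE_natCast, M_mul_Δ_pow, M_E_zero]; simp
    | succ q =>
      rw [EE_natCast, M_mul_Δ_pow, M_E_succ]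
      push_cast
      rw [add_sub_cancel_right, EE_natCast, smul_mul_assoc]
      congr 1; ring
  · intro h
    have h0 : EE q i k = 0 := if_neg (by omega)
    rw [h0, map_zero]
    -- Just above the range, `EE (q - 1) i k` is the last weight vector and need not vanish, but the
    -- scalar does.
    by_cases hq : q = 2 * i + 1
    · subst hq; push_cast; simp
    · have h1 : EE (q - 1) i k = 0 := if_neg (by omega)
      rw [h1, smul_zero]

theorem H_EE (q i k : ℤ) : H (EE q i k) = (2 * q - 2 * i : ℝ) • EE q i k := by
  refine EE_cases (P := fun q i k => H (EE q i k) = (2 * q - 2 * i : ℝ) • EE q i k) q i k ?_ ?_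
  · intro q i k _
    rw [EE_natCast, H_mul_Δ_pow, H_E, smul_mul_assoc]; simp
  · intro h
    have h0 : EE q i k = 0 := if_neg (by omega)
    simp [h0]

theorem dz_EE (q i : ℤ) : dz (EE q i 0) = (i : ℝ) • EE q (i - 1) 0 := by
  refine EE_cases (P := fun q i _ => dz (EE q i 0) = (i : ℝ) • EE q (i - 1) 0) q i 0 ?_ ?_
  · intro q i _ h
    cases i with
    | zero =>
      obtain rfl : q = 0 := by omega
      have := EE_natCast 0 0 0
      push_cast at this ⊢
      rw [this]; simp
    | succ i =>
      have h1 := EE_natCast q (i + 1) 0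
      have h2 := EE_natCast q i 0
      push_cast at h1 h2 ⊢
      rw [h1, add_sub_cancel_right, h2]
      simp [dz_E]
  · intro h
    have h0 : EE q i 0 = 0 := if_neg (by omega)
    have h1 : EE q (i - 1) 0 = 0 := if_neg (by omega)
    simp [h0, h1]

theorem dy_EE (q i : ℤ) : dy (EE q i 0) = (2 * q * i : ℝ) • EE (q - 1) (i - 1) 0 := by
  refine EE_cases (P := fun q i _ => dy (EE q i 0) = (2 * q * i : ℝ) • EE (q - 1) (i - 1) 0)
    q i 0 ?_ ?_
  · intro q i _ h
    cases q with
    | zero =>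
      have := EE_natCast 0 i 0
      push_cast at this ⊢
      rw [this, pow_zero, mul_one, dy_E_zero]; simp
    | succ q =>
      obtain ⟨i, rfl⟩ : ∃ j, i = j + 1 := ⟨i - 1, by omega⟩
      have h1 := EE_natCast (q + 1) (i + 1) 0
      have h2 := EE_natCast q i 0
      push_cast at h1 h2 ⊢
      rw [h1, add_sub_cancel_right, add_sub_cancel_right, h2]
      simp [dy_E_succ]
  · intro h
    have h0 : EE q i 0 = 0 := if_neg (by omega)
    have h1 : EE (q - 1) (i - 1) 0 = 0 := if_neg (by omega)
    simp [h0, h1]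

theorem dx_EE (q i : ℤ) :
    dx (EE q i 0) = (q * (q - 1) * i : ℝ) • EE (q - 2) (i - 1) 0 := by
  refine EE_cases (P := fun q i _ => dx (EE q i 0) = (q * (q - 1) * i : ℝ) • EE (q - 2) (i - 1) 0)
    q i 0 ?_ ?_
  · intro q i _ h
    match q with
    | 0 =>
      have := EE_natCast 0 i 0
      push_cast at this ⊢
      rw [this, pow_zero, mul_one, dx_E_zero]; simp
    | 1 =>
      have := EE_natCast 1 i 0
      push_cast at this ⊢
      rw [this, pow_zero, mul_one, dx_E_one]; simp
    | q + 2 =>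
      obtain ⟨i, rfl⟩ : ∃ j, i = j + 1 := ⟨i - 1, by omega⟩
      have h1 := EE_natCast (q + 2) (i + 1) 0
      have h2 := EE_natCast q i 0
      push_cast at h1 h2 ⊢
      rw [h1, add_sub_cancel_right, add_sub_cancel_right, h2]
      simp only [pow_zero, mul_one, dx_E_succ_succ]
      congr 1; ring
  · intro h
    have h0 : EE q i 0 = 0 := if_neg (by omega)
    have h1 : EE (q - 2) (i - 1) 0 = 0 := if_neg (by omega)
    simp [h0, h1]

theorem EE_mul_Δ_pow {k : ℤ} (hk : 0 ≤ k) (q i : ℤ) (l : ℕ) :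
    EE q i k * Δ ^ l = EE q i (k + l) := by
  unfold EE
  by_cases h : 0 ≤ q ∧ q ≤ 2 * i
  · rw [if_pos (by omega), if_pos (by omega), mul_assoc, ← pow_add]
    congr 2; omega
  · rw [if_neg (by omega), if_neg (by omega), zero_mul]

theorem EE_eq_mul_Δ_pow (q i : ℤ) (k : ℕ) : EE q i k = EE q i 0 * Δ ^ k := by
  rw [EE_mul_Δ_pow le_rfl]; simp

/-- The Poisson bracket of two weight vectors. -/
theorem ham_EE_apply {q₁ : ℤ} (h₁ : 0 ≤ q₁) (i₁ q₂ i₂ : ℤ) (k₁ k₂ : ℕ) :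
    ham (EE q₁ i₁ k₁) (EE q₂ i₂ k₂) =
      ((q₂ * (q₂ - 1) * i₂ : ℝ) • (EE (q₁ + 1) i₁ 0 * EE (q₂ - 2) (i₂ - 1) 0)
        - ((q₁ - i₁) * (2 * q₂ * i₂) : ℝ) • (EE q₁ i₁ 0 * EE (q₂ - 1) (i₂ - 1) 0)
        - (q₁ * (2 * i₁ - q₁ + 1) * i₂ : ℝ) • (EE (q₁ - 1) i₁ 0 * EE q₂ (i₂ - 1) 0))
      * Δ ^ (k₁ + k₂) := by
  have hΔ : ∀ f, ham f Δ = 0 := by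
    intro f
    rw [ham_apply_antisymm]
    have : ham Δ = 0 := by simp [ham, N_Δ, M_Δ, H_Δ]
    rw [this]; simp
  rw [EE_eq_mul_Δ_pow q₁, EE_eq_mul_Δ_pow q₂, ham_mul_Δ_pow, Derivation.leibniz,
    Derivation.leibniz_pow]
  simp only [Derivation.smul_apply, hΔ, smul_zero, zero_add, smul_eq_mul, mul_zero]
  rw [FVF.apply_eq (ham (EE q₁ i₁ 0)), dx_EE, dy_EE, dz_EE, ham_x, ham_y, ham_z, N_EE h₁, H_EE, M_EE]
  have e : (1 / 2 : ℝ) • (2 * q₁ - 2 * i₁ : ℝ) • EE q₁ i₁ 0 = (q₁ - i₁ : ℝ) • EE q₁ i₁ 0 := by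
    rw [smul_smul]; congr 1; ring
  rw [e]
  simp only [Algebra.smul_def, map_mul]
  ring

/-! ### The family `B` consists of Hamiltonian vector fields -/

theorem kappa_pos {l i : ℤ} (hi : 0 ≤ i) (hl : l ≤ i) : 0 < kappa l i := by
  rw [kappa, if_pos ⟨hi, hl⟩]; positivity

theorem kappa_succ {l i : ℤ} (hi : 0 ≤ i) (hl : l + 1 ≤ i) :
    kappa (l + 1) i = kappa l i * (i - l) := by
  rw [kappa, kappa, if_pos ⟨hi, hl⟩, if_pos ⟨hi, by omega⟩]
  obtain ⟨m, hm⟩ : ∃ m : ℕ, i - l = m + 1 := ⟨(i - l - 1).toNat, by omega⟩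
  have h1 : (i - l).toNat = m + 1 := by omega
  have h2 : (i - (l + 1)).toNat = m := by omega
  have h3 : (i - l : ℝ) = m + 1 := by exact_mod_cast hm
  rw [h1, h2, h3, Nat.factorial_succ]
  push_cast
  field_simp

theorem ad_N_pow_ham (n : ℕ) (f : FPS) :
    (LieAlgebra.ad ℝ FVF N ^ n) (ham f) = ham ((N : FPS → FPS)^[n] f) := by
  induction n with
  | zero => rfl
  | succ n ih => rw [pow_succ', Module.End.mul_apply, ih, LieAlgebra.ad_apply, lie_N_ham,
      Function.iterate_succ_apply']

theorem ham_z_pow_mul_Δ_pow (i k : ℕ) :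
    ham (z ^ (i + 1) * Δ ^ k) = (i + 1 : ℝ) • ((z ^ i * Δ ^ k) • M) := by
  rw [ham_mul_Δ_pow]
  have e : ham (z ^ (i + 1)) = (i + 1 : ℝ) • (z ^ i • M) := by
    ext1
    · rw [ham_x, derivation_z_pow]; simp
    · rw [ham_y, ← E_zero, H_E, smul_smul, E_zero]
      simp only [Derivation.smul_apply, M_y, smul_eq_mul, ← pow_succ, ← neg_smul]
      congr 1; push_cast; ring
    · rw [ham_z, derivation_z_pow]; simp
  rw [e]
  ext1 <;> simp <;> congr 1 <;> ring

/-- By `lie_N_ham`, ad_N acts on Hamiltonian fields as N acts on their functions, so everything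
reduces to `ham_z_pow_mul_Δ_pow`. -/
theorem ham_EE (l i k : ℤ) :
    ham (EE (l + 1) (i + 1) k) = ((i + 1) * kappa (l + 1) (2 * i + 2) : ℝ) • B l i k := by
  unfold B
  split_ifs with h
  · obtain ⟨hl, hl', hi, hk⟩ := h
    rw [smul_smul, mul_assoc, mul_inv_cancel₀ (kappa_pos (by omega) (by omega)).ne', mul_one]
    lift i to ℕ using hi
    lift k to ℕ using hk
    obtain ⟨n, rfl⟩ : ∃ n : ℕ, l = n - 1 := ⟨(l + 1).toNat, by omega⟩
    have h1 := EE_natCast n (i + 1) k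
    push_cast at h1
    simp only [sub_add_cancel, Int.toNat_natCast]
    have h2 : E n (i + 1) * Δ ^ k = (N : FPS → FPS)^[n] (z ^ (i + 1) * Δ ^ k) := by
      clear h1 hl hl'
      induction n with
      | zero => rfl
      | succ n ih => rw [Function.iterate_succ_apply', ← ih, N_mul_Δ_pow, N_E]
    rw [h1, h2, ← ad_N_pow_ham, ham_z_pow_mul_Δ_pow, map_smul]
    simp
  · rw [smul_zero]
    by_cases h' : 0 ≤ l + 1 ∧ l + 1 ≤ 2 * (i + 1) ∧ 0 ≤ k
    · obtain ⟨rfl, rfl⟩ : l = -1 ∧ i = -1 := by omega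
      lift k to ℕ using h'.2.2
      have h1 := EE_natCast 0 0 k
      push_cast at h1
      have h2 := ham_mul_Δ_pow 1 k
      have h3 : ham 1 = 0 := by simp [ham]
      simp only [neg_add_cancel, h1, E_zero, pow_zero]
      rw [h2, h3, smul_zero]
    · rw [EE, if_neg h', ham_zero]

theorem B_eq_ham {l i k : ℤ} (h1 : -1 ≤ l) (h2 : l ≤ 2 * i + 1) (h3 : 0 ≤ i) :
    B l i k = ((i + 1) * kappa (l + 1) (2 * i + 2) : ℝ)⁻¹ • ham (EE (l + 1) (i + 1) k) := by
  have hi : (0 : ℝ) < i + 1 := by exact_mod_cast (by omega : 0 < i + 1)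
  have hk := kappa_pos (l := l + 1) (i := 2 * i + 2) (by omega) (by omega)
  rw [ham_EE, smul_smul, inv_mul_cancel₀ (by positivity), one_smul]

/-! ### Shifted powers and the constants `η` -/

theorem poch_zero (a b : ℝ) : poch a b 0 = 1 := rfl

theorem poch_succ (a b : ℝ) (k : ℕ) : poch a b (k + 1) = poch a b k * (a + k * b) :=
  Finset.prod_range_succ _ _

theorem poch_succ' (a b : ℝ) (k : ℕ) : poch a b (k + 1) = a * poch (a + b) b k := by
  unfold poch
  rw [Finset.prod_range_succ', mul_comm]
  congr 1
  · simp
  · refine Finset.prod_congr rfl fun j _ => ?_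
    push_cast; ring

theorem poch_neg_one_eq_zero {n k : ℕ} (h : n < k) : poch n (-1) k = 0 :=
  Finset.prod_eq_zero (Finset.mem_range.2 h) (by ring)

theorem two_mul_sub_one_ne_zero (i j : ℤ) : (2 * i - 1 + j * (-2) : ℝ) ≠ 0 := by
  have : (2 * i - 1 + j * (-2) : ℤ) ≠ 0 := by omega
  exact_mod_cast this

theorem poch_odd_ne_zero (i : ℤ) (k : ℕ) : poch (2 * i - 1) (-2) k ≠ 0 :=
  Finset.prod_ne_zero_iff.2 fun j _ => by exact_mod_cast two_mul_sub_one_ne_zero i j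

theorem eta_natCast (s r i n : ℕ) (hr : r < 2) :
    eta (2 * s + r) i n = (-1) ^ n * poch s (-1) n * poch i (-1) (s + n + r) *
        poch (2 * i - 1) (-2) s * 2 ^ (s + n + r) / (n ! * poch (2 * i - 1) (-2) n) := by
  have h1 : (2 * s + r : ℤ) / 2 = s := by omega
  have h2 : (2 * s + r : ℤ) % 2 = r := by omega
  simp only [eta, h1, h2]
  have h3 : (s + n + r : ℤ).toNat = s + n + r := by omega
  split_ifs with h
  · simp [h3]
  · rw [poch_neg_one_eq_zero (n := i) (k := s + n + r) (by omega)]; simp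

theorem eta_eq_zero_of_lt {s r i n : ℕ} (hr : r < 2) (h : i < s + n + r ∨ s < n) :
    eta (2 * s + r) i n = 0 := by
  rw [eta_natCast s r i n hr]
  rcases h with h | h
  · rw [poch_neg_one_eq_zero h]; simp
  · rw [poch_neg_one_eq_zero h]; simp

/-- This recursion and the next two record what one application of N does to the coefficients in an
expansion by monomials x^a y^r z^c Δ^n. From odd to even, the term with y² = xz - Δ also feeds the
next power of Δ. -/
theorem eta_odd (s i n : ℕ) :
    eta (2 * s + 1) i n = eta (2 * s) i n * (2 * (i - s - n)) := by
  have h1 := eta_natCast s 1 i n (by norm_num)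
  have h0 := eta_natCast s 0 i n (by norm_num)
  simp only [Nat.cast_one, Nat.cast_zero, add_zero] at h0 h1
  rw [h1, h0, poch_succ, pow_succ]
  push_cast
  ring

theorem eta_even_zero (s i : ℕ) :
    eta (2 * (s + 1)) i 0 = eta (2 * s + 1) i 0 * (1 + 2 * (i - s - 1)) := by
  have h1 := eta_natCast s 1 i 0 (by norm_num)
  have h0 := eta_natCast (s + 1) 0 i 0 (by norm_num)
  simp only [Nat.cast_one, Nat.cast_zero, add_zero, Nat.cast_add] at h0 h1
  rw [h1, h0, poch_succ (2 * i - 1 : ℝ) _ s]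
  simp only [poch_zero]
  ring

theorem eta_even_succ (s i n : ℕ) :
    eta (2 * (s + 1)) i (n + 1) = eta (2 * s + 1) i (n + 1) * (1 + 2 * (i - s - 1 - (n + 1))) +
      -(eta (2 * s + 1) i n * (2 * (i - s - 1 - n))) := by
  have h2 := eta_natCast s 1 i (n + 1) (by norm_num)
  have h1 := eta_natCast s 1 i n (by norm_num)
  have h0 := eta_natCast (s + 1) 0 i (n + 1) (by norm_num)
  simp only [Nat.cast_one, Nat.cast_zero, add_zero, Nat.cast_add] at h0 h1 h2
  have e0 : s + 1 + (n + 1) = s + n + 1 + 1 := by ring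
  have e2 : s + (n + 1) + 1 = s + n + 1 + 1 := by ring
  rw [h2, h1, h0, e0, e2, poch_succ (2 * i - 1 : ℝ) _ s, poch_succ' _ _ n, poch_succ (s : ℝ) _ n,
    poch_succ (i : ℝ) _ (s + n + 1),
    poch_succ (2 * i - 1 : ℝ) _ n, Nat.factorial_succ]
  have hw : (2 * i - 1 + n * (-2) : ℝ) ≠ 0 := by exact_mod_cast two_mul_sub_one_ne_zero i n
  have hW : poch (2 * i - 1 : ℝ) (-2) n ≠ 0 := by exact_mod_cast poch_odd_ne_zero i n
  have hs : (s : ℝ) + 1 + -1 = s := by ring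
  rw [hs]
  generalize poch (2 * i - 1 : ℝ) (-2) n = W at *
  generalize poch (2 * i - 1 : ℝ) (-2) s = R
  generalize poch (i : ℝ) (-1) (s + n + 1) = Q
  generalize poch (s : ℝ) (-1) n = P
  have hf : (n ! : ℝ) ≠ 0 := by positivity
  have hn : (n + 1 : ℝ) ≠ 0 := by positivity
  push_cast
  simp only [pow_succ]
  generalize (-1 : ℝ) ^ n = A
  generalize (2 : ℝ) ^ (s + n) = T
  obtain ⟨w, hwd⟩ : ∃ w : ℝ, 2 * i - 1 + n * (-2) = w := ⟨_, rfl⟩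
  rw [hwd] at hw ⊢
  field_simp
  rw [← hwd]
  ring

/-- Regroups a sum in which each term contributes to two neighbouring vectors. The recursion for w
is required only after multiplication by T, so closed forms of the coefficients may fail where the
vectors vanish. -/
theorem sum_shift {V : Type*} [AddCommGroup V] [Module ℝ V] (k : ℕ) (u v w : ℕ → ℝ) (T : ℕ → V)
    (h0 : w 0 = u 0) (h : ∀ n < k, w (n + 1) • T (n + 1) = (u (n + 1) + v n) • T (n + 1))
    (hk : u k • T k = 0) :
    ∑ n ∈ Finset.range k, (u n • T n + v n • T (n + 1)) =
      ∑ n ∈ Finset.range (k + 1), w n • T n := by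
  have h1 := Finset.sum_range_succ (fun n => u n • T n) k
  rw [hk, add_zero, Finset.sum_range_succ'] at h1
  rw [Finset.sum_range_succ', Finset.sum_add_distrib, ← h1, h0,
    Finset.sum_congr rfl fun n hn => h n (Finset.mem_range.1 hn)]
  simp only [add_smul, Finset.sum_add_distrib]
  abel

/-! ### Expansion of weight vectors in monomials -/

theorem N_monomial_even (a c n : ℕ) :
    N (x ^ a * z ^ c * Δ ^ n) = (2 * c : ℝ) • (x ^ a * y * z ^ (c - 1) * Δ ^ n) := by
  -- At c = 0 the truncated exponent c - 1 is harmless because its scalar vanishes.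
  cases c with
  | zero => simp [Derivation.leibniz_pow, N_Δ]
  | succ c =>
    rw [N_mul_Δ_pow, Derivation.leibniz, derivation_z_pow, N_z, Derivation.leibniz_pow, N_x]
    simp only [smul_zero, mul_zero, add_zero, Nat.add_sub_cancel, smul_eq_mul, mul_smul_comm,
      smul_mul_assoc]
    have : x ^ a * (z ^ c * (2 * y)) * Δ ^ n = (2 : ℝ) • (x ^ a * y * z ^ c * Δ ^ n) := by
      rw [two_smul]; ring
    rw [this, smul_smul]
    congr 1; push_cast; ring

theorem N_monomial_odd (a c n : ℕ) :
    N (x ^ a * y * z ^ c * Δ ^ n) = (1 + 2 * c : ℝ) • (x ^ (a + 1) * z ^ c * Δ ^ n) +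
      (-(2 * c) : ℝ) • (x ^ a * z ^ (c - 1) * Δ ^ (n + 1)) := by
  have e : x ^ a * y * z ^ c * Δ ^ n = y * (x ^ a * z ^ c * Δ ^ n) := by ring
  rw [e, Derivation.leibniz, N_monomial_even, N_y]
  cases c with
  | zero => simp; ring
  | succ c =>
    simp only [Nat.add_sub_cancel, smul_eq_mul, mul_smul_comm]
    have e1 : y * (x ^ a * y * z ^ c * Δ ^ n) =
        x ^ (a + 1) * z ^ (c + 1) * Δ ^ n - x ^ a * z ^ c * Δ ^ (n + 1) := by
      have hΔ : y * y = x * z - Δ := by rw [Δ]; ring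
      linear_combination (x ^ a * z ^ c * Δ ^ n) * hΔ
    have e2 : x ^ a * z ^ (c + 1) * Δ ^ n * x = x ^ (a + 1) * z ^ (c + 1) * Δ ^ n := by ring
    rw [e1, e2]
    module

/-- Induction by single applications of N, alternating between the even and the odd formula.
Truncated exponents of z occur only beside a vanishing η. -/
theorem E_expansion (s i : ℕ) :
    E (2 * s) i = ∑ n ∈ Finset.range (s + 1),
      eta (2 * s) i n • (x ^ (s - n) * z ^ (i - s - n) * Δ ^ n) ∧
    E (2 * s + 1) i = ∑ n ∈ Finset.range (s + 1),
      eta (2 * s + 1) i n • (x ^ (s - n) * y * z ^ (i - s - 1 - n) * Δ ^ n) := by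
  have step : ∀ s, E (2 * s) i = ∑ n ∈ Finset.range (s + 1),
      eta (2 * s) i n • (x ^ (s - n) * z ^ (i - s - n) * Δ ^ n) →
      E (2 * s + 1) i = ∑ n ∈ Finset.range (s + 1),
      eta (2 * s + 1) i n • (x ^ (s - n) * y * z ^ (i - s - 1 - n) * Δ ^ n) := by
    intro s h
    rw [← N_E, h, map_sum]
    refine Finset.sum_congr rfl fun n _ => ?_
    rw [Derivation.map_smul, N_monomial_even, smul_smul, eta_odd]
    by_cases hi : s + n ≤ i
    · have e1 : i - s - n - 1 = i - s - 1 - n := by omega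
      rw [e1]
      congr 1
      rw [Nat.sub_sub, Nat.cast_sub hi]; push_cast; ring
    · have h0 := eta_eq_zero_of_lt (s := s) (r := 0) (i := i) (n := n) (by norm_num)
        (by left; omega)
      simp only [Nat.cast_zero, add_zero] at h0
      simp [h0]
  suffices h : E (2 * s) i = ∑ n ∈ Finset.range (s + 1),
      eta (2 * s) i n • (x ^ (s - n) * z ^ (i - s - n) * Δ ^ n) from ⟨h, step s h⟩
  induction s with
  | zero =>
    have := eta_natCast 0 0 i 0 (by norm_num)
    simp [poch_zero] at this
    simp [this]
  | succ s ih =>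
    have h := step s ih
    have e : 2 * (s + 1) = 2 * s + 1 + 1 := by ring
    rw [e, ← N_E, h, map_sum]
    have hlt : ∀ n : ℕ, i < s + n + 1 ∨ s < n → eta (2 * s + 1) i n = 0 := fun n hn => by
      simpa using eta_eq_zero_of_lt (s := s) (r := 1) (i := i) (n := n) (by norm_num) hn
    rw [← sum_shift (s + 1) (fun n => eta (2 * s + 1) i n * (1 + 2 * (i - s - 1 - n)))
      (fun n => -(eta (2 * s + 1) i n * (2 * (i - s - 1 - n))))
      (fun n => eta (2 * ((s + 1 : ℕ) : ℤ)) i n)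
      (fun n => x ^ (s + 1 - n) * z ^ (i - (s + 1) - n) * Δ ^ n)]
    · refine Finset.sum_congr rfl fun n hn => ?_
      have hn' : n ≤ s := Nat.lt_succ_iff.1 (Finset.mem_range.1 hn)
      rw [Derivation.map_smul, N_monomial_odd, smul_add, smul_smul, smul_smul]
      by_cases hi : s + 1 + n ≤ i
      · have e1 : s - n + 1 = s + 1 - n := by omega
        have e2 : i - s - 1 - n = i - (s + 1) - n := by omega
        have e3 : s - n = s + 1 - (n + 1) := by omega
        have e4 : i - (s + 1) - n - 1 = i - (s + 1) - (n + 1) := by omega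
        have ec : ((i - (s + 1) - n : ℕ) : ℝ) = i - s - 1 - n := by
          rw [Nat.sub_sub, Nat.cast_sub hi]; push_cast; ring
        rw [e1, e2, e3, e4, ec]
        congr 2
        ring
      · simp [hlt n (by left; omega)]
    · have := eta_even_zero s i
      push_cast
      rw [this]; ring
    · intro n _
      have := eta_even_succ s i n
      push_cast
      rw [this]
    · have := hlt (s + 1) (by right; omega)
      push_cast at this
      simp [this]

/-! ### Expansion of monomials in weight vectors -/

theorem x_mul_EE {q k : ℤ} (hq : 0 ≤ q) (hk : 0 ≤ k) (i : ℤ) :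
    x * EE q i k = (2 * (i + 1) * (2 * i + 1) : ℝ)⁻¹ • EE (q + 2) (i + 1) k +
      (2 * i / (2 * i + 1) : ℝ) • EE q (i - 1) (k + 1) := by
  by_cases h : 2 * i < q
  · rw [EE_of_lt h, EE_of_lt (by omega), EE_of_lt (by omega)]; simp
  lift q to ℕ using hq
  lift k to ℕ using hk
  lift i to ℕ using by omega
  have e2 := EE_natCast (q + 2) (i + 1) k
  push_cast at e2
  rw [EE_natCast, e2]
  have hi : (2 * (i + 1) * (2 * i + 1) : ℝ) ≠ 0 := by positivity
  cases i with
  | zero =>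
    have := congrArg (· * Δ ^ k) (x_mul_E_zero q)
    simp only [smul_mul_assoc] at this
    rw [← this]
    simp [mul_assoc]
  | succ i =>
    have e3 := EE_natCast q i (k + 1)
    push_cast at e3 hi ⊢
    rw [add_sub_cancel_right, e3]
    have := congrArg (· * Δ ^ k) (x_mul_E q i)
    simp only [smul_mul_assoc, add_mul] at this
    have e4 : E (q + 1 + 1) (i + 1 + 1) = E (q + 2) (i + 2) := rfl
    rw [eq_sub_of_add_eq this.symm, smul_sub, smul_smul, smul_smul, pow_succ]
    have e5 : Δ * E q i * Δ ^ k = E q i * (Δ ^ k * Δ) := by ring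
    have e6 : (2 * (i + 1 + 1) * (2 * (i + 1) + 1) : ℝ)⁻¹ * (2 * (i + 2) * (2 * i + 3)) = 1 := by
      field_simp; ring
    have e7 : (2 * (i + 1 + 1) * (2 * (i + 1) + 1) : ℝ)⁻¹ * (4 * (i + 1) * (i + 2)) =
        2 * (i + 1) / (2 * (i + 1) + 1) := by field_simp; ring
    rw [e5, e6, e7, mul_assoc x]
    module

/-- The product of the first `n` odd numbers. -/
def oddProd (n : ℕ) : ℝ := ∏ j ∈ Finset.range n, (2 * j + 1 : ℝ)

theorem oddProd_succ (n : ℕ) : oddProd (n + 1) = oddProd n * (2 * n + 1) :=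
  Finset.prod_range_succ _ _

theorem oddProd_pos (n : ℕ) : 0 < oddProd n := Finset.prod_pos fun _ _ => by positivity

/-- The coefficient of `E (2 p + ρ) (p + c + ρ) * Δ ^ m` in `x ^ (p + m) * y ^ ρ * z ^ (c + m)`. -/
def monCoeff (p c ρ m : ℕ) : ℝ :=
  (p + m)! * (c + m)! * 2 ^ m * (2 * (p + c + ρ) + 1) * oddProd (c + ρ) /
    (2 ^ (p + ρ) * p ! * m ! * (p + c + ρ)! * oddProd (p + c + ρ + m + 1))

/-- By `x_mul_EE`, a factor x sends each weight vector to one with the same power of Δ and one with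
the next power. The three recursions here treat the first, the last and the intermediate
coefficients of the resulting expansion. -/
theorem monCoeff_succ_zero (p c ρ : ℕ) :
    monCoeff (p + 1) c ρ 0 = monCoeff p c ρ 0 *
      (2 * ((p + c + ρ) + 1) * (2 * (p + c + ρ) + 1) : ℝ)⁻¹ := by
  unfold monCoeff
  have e1 : p + 1 + c + ρ = p + c + ρ + 1 := by ring
  have e2 : p + 1 + ρ = p + ρ + 1 := by ring
  simp only [e1, e2, add_zero, oddProd_succ, Nat.factorial_succ, pow_succ]
  have := oddProd_pos (p + c + ρ)
  push_cast
  field_simp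
  ring

theorem monCoeff_zero_succ (c ρ m : ℕ) :
    monCoeff 0 c ρ (m + 1) =
      monCoeff 0 (c + 1) ρ m * (2 * (c + 1 + ρ) / (2 * (c + 1 + ρ) + 1)) := by
  unfold monCoeff
  have e1 : c + ρ + (m + 1) + 1 = c + ρ + m + 2 := by ring
  have e2 : c + ρ + 1 + m + 1 = c + ρ + m + 2 := by ring
  have e3 : c + (m + 1) = c + 1 + m := by ring
  have e5 : c + 1 + ρ = c + ρ + 1 := by ring
  simp only [e1, e2, e3, e5, zero_add]
  rw [oddProd_succ (c + ρ), Nat.factorial_succ m, Nat.factorial_succ (c + ρ)]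
  have := oddProd_pos (c + ρ + m + 2)
  push_cast
  field_simp
  ring

theorem monCoeff_succ_succ (p c ρ m : ℕ) :
    monCoeff (p + 1) c ρ (m + 1) = monCoeff p c ρ (m + 1) *
      (2 * ((p + c + ρ) + 1) * (2 * (p + c + ρ) + 1) : ℝ)⁻¹ +
      monCoeff (p + 1) (c + 1) ρ m *
        (2 * (p + c + ρ + 2) / (2 * (p + c + ρ + 2) + 1)) := by
  unfold monCoeff
  have e1 : p + c + ρ + 1 + (m + 1) + 1 = p + c + ρ + m + 2 + 1 := by ring
  have e2 : p + c + ρ + 1 + 1 + m + 1 = p + c + ρ + m + 2 + 1 := by ring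
  have e3 : p + c + ρ + (m + 1) + 1 = p + c + ρ + m + 2 := by ring
  have e4 : p + 1 + (c + 1) + ρ = p + c + ρ + 1 + 1 := by ring
  have e5 : p + 1 + c + ρ = p + c + ρ + 1 := by ring
  have e6 : c + 1 + ρ = c + ρ + 1 := by ring
  have e7 : p + 1 + (m + 1) = p + m + 1 + 1 := by ring
  have e8 : p + 1 + m = p + m + 1 := by ring
  have e9 : c + 1 + m = c + (m + 1) := by ring
  have e10 : p + (m + 1) = p + m + 1 := by ring
  have e11 : p + 1 + ρ = p + ρ + 1 := by ring
  simp only [e1, e2, e3, e4, e5, e6, e7, e8, e9, e10, e11]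
  rw [oddProd_succ (c + ρ), oddProd_succ (p + c + ρ + m + 2), Nat.factorial_succ m,
    Nat.factorial_succ (p + c + ρ + 1), Nat.factorial_succ (p + c + ρ),
    Nat.factorial_succ (p + m + 1), Nat.factorial_succ p, pow_succ, pow_succ]
  have := oddProd_pos (p + c + ρ + m + 2)
  push_cast
  field_simp
  ring

/-- Induction on the exponent of x through `x_mul_EE`; for P = 0 the monomial is a multiple of
N^ρ(z^(c+ρ)). For m > c the truncated c - m does no harm, because the weight vector is then out of
range. -/
theorem monomial_expansion (P c ρ : ℕ) (hρ : ρ < 2) :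
    x ^ P * y ^ ρ * z ^ c = ∑ m ∈ Finset.range (P + 1),
      monCoeff (P - m) (c - m) ρ m • EE (2 * (P - m) + ρ) (P + c + ρ - 2 * m) m := by
  induction P with
  | zero =>
    have e := EE_natCast ρ (c + ρ) 0
    push_cast at e
    have hc : monCoeff 0 c ρ 0 = c ! / (2 ^ ρ * (c + ρ)!) := by
      have := oddProd_pos (c + ρ)
      simp only [monCoeff, add_zero, zero_add, oddProd_succ]
      push_cast
      field_simp
      simp
    simp only [zero_add, Finset.sum_range_one, Nat.sub_zero, Nat.cast_zero, sub_zero, mul_zero, hc, e,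
      pow_zero, one_mul, mul_one]
    interval_cases ρ
    · simp [Nat.factorial_ne_zero]
    · rw [← N_E, E_zero, derivation_z_pow, N_z, smul_smul, Nat.factorial_succ]
      have h2 : z ^ c * (2 * y) = (2 : ℝ) • (y * z ^ c) := by rw [two_smul]; ring
      rw [h2, smul_smul, pow_one]
      have : ((c ! : ℝ) / (2 ^ 1 * ((c + 1) * c ! : ℕ)) * (c + 1 : ℕ) * 2) = 1 := by
        push_cast; field_simp
      rw [this, one_smul]
  | succ P ih =>
    have e : x ^ (P + 1) * y ^ ρ * z ^ c = x * (x ^ P * y ^ ρ * z ^ c) := by ring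
    rw [e, ih, Finset.mul_sum]
    set α : ℕ → ℝ := fun n => (2 * ((P + c + ρ - 2 * n) + 1) * (2 * (P + c + ρ - 2 * n) + 1))⁻¹
    set β : ℕ → ℝ := fun n => 2 * (P + c + ρ - 2 * n) / (2 * (P + c + ρ - 2 * n) + 1)
    -- The cutoff at n ≤ P makes the first family vanish at the end point P + 1, as `sum_shift`
    -- requires.
    rw [← sum_shift (P + 1)
      (fun n => if n ≤ P then monCoeff (P - n) (c - n) ρ n * α n else 0)
      (fun n => monCoeff (P - n) (c - n) ρ n * β n)]
    · refine Finset.sum_congr rfl fun n hn => ?_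
      have hn' : n ≤ P := Nat.lt_succ_iff.1 (Finset.mem_range.1 hn)
      rw [mul_smul_comm, x_mul_EE (by omega) (by omega), if_pos hn', smul_add, smul_smul, smul_smul]
      congr 2
      · simp only [α]; push_cast; rfl
      · congr 1 <;> push_cast <;> ring
      · simp only [β]; push_cast; rfl
      · congr 1 <;> push_cast <;> ring
    · simp only [Nat.sub_zero, Nat.zero_le, if_true, monCoeff_succ_zero, α]
      simp
    · intro n hn
      by_cases hc : c ≤ n
      · rw [EE_of_lt (by push_cast; omega), smul_zero, smul_zero]
      · obtain ⟨d, rfl⟩ : ∃ d, c = d + (n + 1) := ⟨c - (n + 1), by omega⟩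
        have h1 : d + (n + 1) - (n + 1) = d := by omega
        have h2 : d + (n + 1) - n = d + 1 := by omega
        congr 1
        simp only [h1, h2, α, β]
        rcases Nat.lt_succ_iff_lt_or_eq.1 hn with hn | rfl
        · obtain ⟨p, rfl⟩ : ∃ p, P = p + (n + 1) := ⟨P - (n + 1), by omega⟩
          have h3 : p + (n + 1) + 1 - (n + 1) = p + 1 := by omega
          have h4 : p + (n + 1) - (n + 1) = p := by omega
          have h5 : p + (n + 1) - n = p + 1 := by omega
          rw [if_pos (by omega), h3, h4, h5, monCoeff_succ_succ]
          push_cast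
          congr 3 <;> ring
        · rw [if_neg (by omega), Nat.sub_self, Nat.sub_self, monCoeff_zero_succ]
          push_cast
          rw [zero_add]
          congr 2 <;> ring
    · simp

theorem poch_one_mul_factorial (p m : ℕ) : poch (p + 1) 1 m * p ! = (p + m)! := by
  induction m with
  | zero => simp [poch_zero]
  | succ m ih =>
    rw [poch_succ, ← add_assoc, Nat.factorial_succ]
    push_cast
    rw [← ih]; ring

theorem poch_neg_one_mul_factorial (c n : ℕ) :
    poch (n + c : ℕ) (-1) n * c ! = (n + c)! := by
  induction n with
  | zero => simp [poch_zero]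
  | succ n ih =>
    have h : ((n + 1 + c : ℕ) : ℝ) + -1 = (n + c : ℕ) := by push_cast; ring
    have h' : n + 1 + c = n + c + 1 := by ring
    rw [poch_succ', h, mul_assoc, ih, h', Nat.factorial_succ]
    push_cast; ring

theorem poch_neg_two_mul_oddProd (n p : ℕ) :
    poch (2 * (p + n : ℕ) - 1) (-2) p * oddProd n = oddProd (p + n) := by
  induction p with
  | zero => simp [poch_zero]
  | succ p ih =>
    have h : 2 * ((p + 1 + n : ℕ) : ℝ) - 1 + -2 = 2 * (p + n : ℕ) - 1 := by push_cast; ring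
    have h' : p + 1 + n = p + n + 1 := by ring
    rw [poch_succ', h, mul_assoc, ih, h', oddProd_succ]
    push_cast; ring

theorem poch_two_mul_oddProd (n m : ℕ) :
    poch (2 * n + 3) 2 m * oddProd (n + 1) = oddProd (n + m + 1) := by
  induction m with
  | zero => simp [poch_zero]
  | succ m ih =>
    have h' : n + (m + 1) + 1 = n + m + 1 + 1 := by ring
    rw [poch_succ, h', oddProd_succ (n + m + 1), ← ih]
    push_cast; ring

/-- The left side is the form in which these coefficients enter the constants C. Every shifted power
in it is a quotient of factorials or of products of odd numbers. -/
theorem monCoeff_eq (p c ρ m : ℕ) (hρ : ρ < 2) :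
    poch (p + 1) 1 m * poch (c + 1) 1 m /
      (eta (2 * p + ρ) (p + c + ρ : ℕ) 0 * m ! * (2 : ℝ) ^ (-(m : ℤ)) *
        poch (2 * (p + c + ρ : ℕ) + 3) 2 m) = monCoeff p c ρ m := by
  have h1 := poch_one_mul_factorial p m
  have h2 := poch_one_mul_factorial c m
  have h3 := poch_neg_one_mul_factorial c (p + ρ)
  have h4 := poch_neg_two_mul_oddProd (c + ρ) p
  have h5 := poch_two_mul_oddProd (p + c + ρ) m
  have e1 : p + ρ + c = p + c + ρ := by ring
  have e2 : p + (c + ρ) = p + c + ρ := by ring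
  rw [e1] at h3
  rw [e2] at h4
  have h0 := eta_natCast p ρ (p + c + ρ) 0 hρ
  simp only [Nat.cast_zero, pow_zero, poch_zero, Nat.factorial_zero, Nat.cast_one, add_zero,
    mul_one, one_mul, div_one] at h0
  rw [oddProd_succ, ← h4] at h5
  unfold monCoeff
  rw [h0, ← h1, ← h2, ← h3, ← h5, zpow_neg, zpow_natCast]
  have p1 : poch ((p + c + ρ : ℕ) : ℝ) (-1) (p + ρ) ≠ 0 := by
    intro h; rw [h, zero_mul] at h3; exact (Nat.cast_ne_zero.2 (Nat.factorial_ne_zero _)) h3.symm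
  have p2 : poch (2 * ((p + c + ρ : ℕ) : ℝ) - 1) (-2) p ≠ 0 := by
    intro h; rw [h, zero_mul] at h4; exact (oddProd_pos _).ne h4
  have p3 : poch (2 * ((p + c + ρ : ℕ) : ℝ) + 3) 2 m ≠ 0 := by
    intro h; rw [h, zero_mul] at h5; exact (oddProd_pos _).ne h5
  have p4 := (oddProd_pos (c + ρ)).ne'
  push_cast at p1 p2 p3 ⊢
  field_simp

/-! ### Products of weight vectors -/

theorem sum_Icc_zero_natCast {V : Type*} [AddCommMonoid V] (f : ℤ → V) (n : ℕ) :
    ∑ r ∈ Finset.Icc (0 : ℤ) n, f r = ∑ r ∈ Finset.range (n + 1), f r := by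
  refine Finset.sum_nbij' Int.toNat (fun r => (r : ℤ)) ?_ ?_ ?_ ?_ ?_
  · intro r hr; simp only [Finset.mem_Icc, Finset.mem_range] at *; omega
  · intro r hr; simp only [Finset.mem_Icc, Finset.mem_range] at *; omega
  · intro r hr; simp only [Finset.mem_Icc] at hr; omega
  · intro r _; simp
  · intro r hr
    simp only [Finset.mem_Icc] at hr
    rw [Int.toNat_of_nonneg hr.1]

theorem sum_mul_smul_eq_sum_convolution {V : Type*} [AddCommGroup V] [Module ℝ V]
    (f g : ℕ → ℝ) (G : ℕ → V) (A K : ℕ)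
    (hf : ∀ n, A ≤ n → f n = 0) (hg : ∀ n, K ≤ n → g n = 0) :
    ∑ n ∈ Finset.range A, ∑ m ∈ Finset.range K, (f n * g m) • G (n + m) =
      ∑ k ∈ Finset.range (A + K), (∑ n ∈ Finset.range (k + 1), f n * g (k - n)) • G k := by
  have h := Finset.sum_range_diag_flip (A + K) (fun n m => (f n * g m) • G (n + m))
  have h' : ∀ k ∈ Finset.range (A + K),
      (∑ n ∈ Finset.range (k + 1), f n * g (k - n)) • G k =
      ∑ n ∈ Finset.range (k + 1), (f n * g (k - n)) • G (n + (k - n)) := by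
    intro k _
    rw [Finset.sum_smul]
    refine Finset.sum_congr rfl fun n hn => ?_
    rw [Nat.add_sub_cancel' (Nat.lt_succ_iff.1 (Finset.mem_range.1 hn))]
  rw [Finset.sum_congr rfl h', h]
  refine (Finset.sum_subset (fun n hn => ?_) fun n _ hn => ?_).trans
    (Finset.sum_congr rfl fun n hn => ?_) <;> simp only [Finset.mem_range] at *
  · omega
  · exact Finset.sum_eq_zero fun m _ => by rw [hf n (by omega)]; simp
  · by_cases hA : A ≤ n
    · rw [Finset.sum_eq_zero, Finset.sum_eq_zero] <;> intro m _ <;> rw [hf n hA] <;> simp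
    · refine Finset.sum_subset (fun m hm => ?_) fun m _ hm => ?_ <;>
        simp only [Finset.mem_range] at *
      · omega
      · rw [hg m (by omega)]; simp

theorem E_expansion' (s r i : ℕ) (hr : r < 2) :
    E (2 * s + r) i = ∑ n ∈ Finset.range (s + 1),
      eta (2 * s + r) i n • (x ^ (s - n) * y ^ r * z ^ (i - s - r - n) * Δ ^ n) := by
  interval_cases r
  · simpa using (E_expansion s i).1
  · simpa using (E_expansion s i).2

theorem etaTilde_natCast (q₁ q₂ i j : ℤ) (n : ℕ) :
    etaTilde q₁ q₂ n i j = ∑ a ∈ Finset.range (n + 1), eta q₁ i a * eta q₂ j ((n - a : ℕ) : ℤ) := by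
  rw [etaTilde, sum_Icc_zero_natCast]
  refine Finset.sum_congr rfl fun a ha => ?_
  rw [Nat.cast_sub (Nat.lt_succ_iff.1 (Finset.mem_range.1 ha))]

theorem etaTilde_eq_zero {s₁ s₂ r₁ r₂ i j n : ℕ} (h₁ : r₁ < 2) (h₂ : r₂ < 2)
    (h : s₁ + s₂ < n ∨ i + j < s₁ + s₂ + r₁ + r₂ + n) :
    etaTilde (2 * s₁ + r₁) (2 * s₂ + r₂) n i j = 0 := by
  rw [etaTilde_natCast]
  refine Finset.sum_eq_zero fun a ha => ?_
  have ha := Finset.mem_range.1 ha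
  by_cases h' : i < s₁ + a + r₁ ∨ s₁ < a
  · rw [eta_eq_zero_of_lt h₁ h', zero_mul]
  · rw [eta_eq_zero_of_lt h₂ (by omega), mul_zero]

/-- The coefficients of the product of two weight vectors in terms of monomials. -/
def prodCoeff (q₁ q₂ : ℤ) (f : ℕ) (i j n : ℤ) : ℝ :=
  etaTilde q₁ q₂ n i j - f * etaTilde q₁ q₂ (n - 1) i j

/-- A Cauchy product of two monomial expansions. If both powers of N are odd (f = 1), each product
contains y² = xz - Δ and splits as T k - T (k+1); this is the origin of the correction -ε η̃_{r-1}.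
Here S and c are the exponents of x and z in the term without Δ. -/
theorem E_mul_E_eq_sum_monomials {s₁ s₂ r₁ r₂ i j : ℕ} (h₁ : r₁ < 2) (h₂ : r₂ < 2)
    (hi : s₁ + r₁ ≤ i) (hj : s₂ + r₂ ≤ j) {f ρ S c : ℕ} (hf : 2 * f + ρ = r₁ + r₂) (hρ : ρ < 2)
    (hS : S = s₁ + s₂ + f) (hc : c + s₁ + s₂ + r₁ + r₂ = i + j + f) :
    E (2 * s₁ + r₁) i * E (2 * s₂ + r₂) j = ∑ n ∈ Finset.range (S + 1),
      prodCoeff (2 * s₁ + r₁) (2 * s₂ + r₂) f i j n •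
        (x ^ (S - n) * y ^ ρ * z ^ (c - n) * Δ ^ n) := by
  set G : ℕ → FPS := fun n =>
    x ^ (s₁ + s₂ - n) * y ^ (r₁ + r₂) * z ^ (i + j - s₁ - s₂ - r₁ - r₂ - n) * Δ ^ n with hG
  set T : ℕ → FPS := fun n => x ^ (S - n) * y ^ ρ * z ^ (c - n) * Δ ^ n with hT
  have e1 : E (2 * s₁ + r₁) i * E (2 * s₂ + r₂) j =
      ∑ k ∈ Finset.range (s₁ + 1 + (s₂ + 1)),
        etaTilde (2 * s₁ + r₁) (2 * s₂ + r₂) k i j • G k := by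
    simp only [etaTilde_natCast]
    rw [← sum_mul_smul_eq_sum_convolution (fun n => eta (2 * s₁ + r₁) i n)
      (fun n => eta (2 * s₂ + r₂) j n) G (s₁ + 1) (s₂ + 1)
      (fun n hn => eta_eq_zero_of_lt h₁ (by omega)) (fun n hn => eta_eq_zero_of_lt h₂ (by omega)),
      E_expansion' s₁ r₁ i h₁, E_expansion' s₂ r₂ j h₂, Finset.sum_mul_sum]
    refine Finset.sum_congr rfl fun n hn => Finset.sum_congr rfl fun m hm => ?_
    simp only [Finset.mem_range] at hn hm
    rw [smul_mul_smul_comm]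
    by_cases hn' : i < s₁ + n + r₁
    · rw [eta_eq_zero_of_lt h₁ (Or.inl hn')]; simp
    by_cases hm' : j < s₂ + m + r₂
    · rw [eta_eq_zero_of_lt h₂ (Or.inl hm')]; simp
    congr 1
    have a1 : s₁ + s₂ - (n + m) = (s₁ - n) + (s₂ - m) := by omega
    have a2 : i + j - s₁ - s₂ - r₁ - r₂ - (n + m) =
      (i - s₁ - r₁ - n) + (j - s₂ - r₂ - m) := by omega
    simp only [hG, a1, a2, pow_add]
    ring
  have e2 : ∀ k ∈ Finset.range (s₁ + 1 + (s₂ + 1)),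
      etaTilde (2 * s₁ + r₁) (2 * s₂ + r₂) k i j • G k =
      etaTilde (2 * s₁ + r₁) (2 * s₂ + r₂) k i j • T k +
        (-(f * etaTilde (2 * s₁ + r₁) (2 * s₂ + r₂) k i j)) • T (k + 1) := by
    intro k _
    by_cases h : s₁ + s₂ < k ∨ i + j < s₁ + s₂ + r₁ + r₂ + k
    · rw [etaTilde_eq_zero h₁ h₂ h]; simp
    rcases Nat.lt_or_ge f 1 with hf0 | hf1
    · obtain rfl : f = 0 := by omega
      obtain rfl : ρ = r₁ + r₂ := by omega
      have a1 : S = s₁ + s₂ := by omega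
      have a2 : i + j - s₁ - s₂ - r₁ - r₂ = c := by omega
      simp [hG, hT, a1, a2]
    · obtain rfl : f = 1 := by omega
      obtain rfl : ρ = 0 := by omega
      have a0 : r₁ + r₂ = 2 := by omega
      have a1 : S - k = (s₁ + s₂ - k) + 1 := by omega
      have a2 : S - (k + 1) = s₁ + s₂ - k := by omega
      have a3 : c - k = (i + j - s₁ - s₂ - r₁ - r₂ - k) + 1 := by omega
      have a4 : c - (k + 1) = i + j - s₁ - s₂ - r₁ - r₂ - k := by omega
      have a5 : G k = T k - T (k + 1) := by
        simp only [hG, hT, a0, a1, a2, a3, a4]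
        have hΔ : y ^ 2 = x * z - Δ := by rw [Δ]; ring
        rw [hΔ]; ring
      rw [a5]
      push_cast
      module
  rw [e1, Finset.sum_congr rfl e2, sum_shift _ _ _
    (fun n => prodCoeff (2 * s₁ + r₁) (2 * s₂ + r₂) f i j n) T]
  · refine (Finset.sum_subset (fun n hn => ?_) fun n _ hn => ?_).symm <;>
      simp only [Finset.mem_range] at *
    · omega
    · obtain ⟨n, rfl⟩ : ∃ m, n = m + 1 := ⟨n - 1, by omega⟩
      have h0 := etaTilde_eq_zero (s₁ := s₁) (s₂ := s₂) (i := i) (j := j) (n := n + 1) h₁ h₂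
        (by left; omega)
      rw [prodCoeff, h0]
      push_cast
      rw [add_sub_cancel_right]
      rcases Nat.lt_or_ge f 1 with hf0 | hf1
      · obtain rfl : f = 0 := by omega
        simp
      · rw [etaTilde_eq_zero h₁ h₂ (by left; omega)]; simp
  · simp [prodCoeff, etaTilde]
  · intro n _
    simp only [prodCoeff]
    push_cast
    rw [add_sub_cancel_right, ← sub_eq_add_neg]
  · rw [etaTilde_eq_zero h₁ h₂ (by left; omega), zero_smul]

theorem E_mul_E_natCast {s₁ s₂ r₁ r₂ i j : ℕ} (h₁ : r₁ < 2) (h₂ : r₂ < 2)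
    (hi : s₁ + r₁ ≤ i) (hj : s₂ + r₂ ≤ j) {f ρ S c : ℕ} (hf : 2 * f + ρ = r₁ + r₂) (hρ : ρ < 2)
    (hS : S = s₁ + s₂ + f) (hc : c + s₁ + s₂ + r₁ + r₂ = i + j + f) :
    E (2 * s₁ + r₁) i * E (2 * s₂ + r₂) j = ∑ k ∈ Finset.range (S + 1),
      (∑ n ∈ Finset.range (k + 1), prodCoeff (2 * s₁ + r₁) (2 * s₂ + r₂) f i j n *
        monCoeff (S - k) (c - k) ρ (k - n)) • EE (2 * (S - k) + ρ) (S + c + ρ - 2 * k) k := by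
  rw [E_mul_E_eq_sum_monomials h₁ h₂ hi hj hf hρ hS hc]
  have h := Finset.sum_range_diag_flip (S + 1) (fun n m =>
    (prodCoeff (2 * s₁ + r₁) (2 * s₂ + r₂) f i j n *
      monCoeff (S - (n + m)) (c - (n + m)) ρ m) •
        EE (2 * (S - (n + m : ℕ)) + ρ) (S + c + ρ - 2 * (n + m : ℕ)) (n + m : ℕ))
  have h' : ∀ k ∈ Finset.range (S + 1),
      (∑ n ∈ Finset.range (k + 1), prodCoeff (2 * s₁ + r₁) (2 * s₂ + r₂) f i j n *
        monCoeff (S - k) (c - k) ρ (k - n)) • EE (2 * (S - k) + ρ) (S + c + ρ - 2 * k) k =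
      ∑ n ∈ Finset.range (k + 1), (prodCoeff (2 * s₁ + r₁) (2 * s₂ + r₂) f i j n *
      monCoeff (S - (n + (k - n))) (c - (n + (k - n))) ρ (k - n)) •
        EE (2 * (S - (n + (k - n) : ℕ)) + ρ) (S + c + ρ - 2 * (n + (k - n) : ℕ))
          (n + (k - n) : ℕ) := by
    intro k _
    rw [Finset.sum_smul]
    refine Finset.sum_congr rfl fun n hn => ?_
    rw [Nat.add_sub_cancel' (Nat.lt_succ_iff.1 (Finset.mem_range.1 hn))]
  rw [Finset.sum_congr rfl h', h]
  refine Finset.sum_congr rfl fun n hn => ?_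
  have hn := Finset.mem_range.1 hn
  -- Here c - n is truncated and the indices would not match, but the coefficient of the monomial is
  -- zero.
  by_cases hcn : c < n
  · have h0 : prodCoeff (2 * s₁ + r₁) (2 * s₂ + r₂) f i j n = 0 := by
      obtain ⟨n, rfl⟩ : ∃ m, n = m + 1 := ⟨n - 1, by omega⟩
      rw [prodCoeff, etaTilde_eq_zero h₁ h₂ (by right; omega)]
      push_cast
      rw [add_sub_cancel_right]
      rcases Nat.lt_or_ge f 1 with hf0 | hf1
      · obtain rfl : f = 0 := by omega
        simp
      · rw [etaTilde_eq_zero h₁ h₂ (by right; omega)]; simp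
    simp [h0]
  · rw [monomial_expansion _ _ _ hρ, Finset.sum_mul, Finset.smul_sum]
    have e : S - n + 1 = S + 1 - n := by omega
    rw [e]
    refine Finset.sum_congr rfl fun m _ => ?_
    rw [smul_mul_assoc, EE_mul_Δ_pow (by omega), smul_smul, Nat.sub_sub, Nat.sub_sub]
    congr 1
    congr 1 <;> push_cast <;> omega

/-- The index p of C runs opposite to the exponent k of Δ: p = S - k. -/
theorem C_natCast {s₁ s₂ r₁ r₂ i j : ℕ} (h₁ : r₁ < 2) (h₂ : r₂ < 2)
    {f ρ S c k : ℕ} (hf : 2 * f + ρ = r₁ + r₂) (hρ : ρ < 2)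
    (hS : S = s₁ + s₂ + f) (hc : c + s₁ + s₂ + r₁ + r₂ = i + j + f) (hk : k ≤ S) (hk' : k ≤ c) :
    C (2 * s₁ + r₁) (2 * s₂ + r₂) (S - k) i j =
      ∑ n ∈ Finset.range (k + 1), prodCoeff (2 * s₁ + r₁) (2 * s₂ + r₂) f i j n *
        monCoeff (S - k) (c - k) ρ (k - n) := by
  obtain ⟨p, rfl⟩ := Nat.exists_eq_add_of_le' hk
  obtain ⟨d, rfl⟩ := Nat.exists_eq_add_of_le' hk'
  have a1 : (2 * s₁ + r₁ : ℤ) / 2 = s₁ := by omega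
  have a2 : (2 * s₁ + r₁ : ℤ) % 2 = r₁ := by omega
  have a3 : (2 * s₂ + r₂ : ℤ) / 2 = s₂ := by omega
  have a4 : (2 * s₂ + r₂ : ℤ) % 2 = r₂ := by omega
  have a5 : (r₁ + r₂ : ℤ) / 2 = f := by omega
  have a6 : |(r₂ - r₁ : ℤ)| = ρ := by
    interval_cases r₁ <;> interval_cases r₂ <;> simp <;> omega
  have a7 : ((p + k : ℕ) : ℤ) - k = p := by push_cast; ring
  have a8 : (s₁ + s₂ + f - p : ℤ) = k := by omega
  simp only [C, a1, a2, a3, a4, a5, a6, a7, a8, sum_Icc_zero_natCast, Nat.add_sub_cancel]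
  refine Finset.sum_congr rfl fun n hn => ?_
  have hn := Finset.mem_range.1 hn
  obtain ⟨m, rfl⟩ : ∃ m, k = n + m := ⟨k - n, by omega⟩
  have b1 : (s₁ + s₂ - p - n + f : ℤ).toNat = m := by omega
  have b2 : (p + n - (s₁ + s₂ + f) : ℤ) = -(m : ℤ) := by omega
  have b3 : n + m - n = m := by omega
  have b4 : sigma2 (2 * s₁ + r₁) (2 * s₂ + r₂) i j = p - d := by
    rw [sigma2]; omega
  have b5 : (2 * p - (p - d) + ρ : ℤ) = (p + d + ρ : ℕ) := by push_cast; ring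
  rw [b1, b2, b3, b4, b5, ← monCoeff_eq p d ρ m hρ, prodCoeff]
  push_cast
  have b6 : (p - (p - d) + 1 : ℝ) = d + 1 := by ring
  have b7 : (4 * p - 2 * (p - d) + 3 + 2 * ρ : ℝ) = 2 * (p + d + ρ) + 3 := by ring
  rw [b6, b7]
  ring

theorem C_eq_zero {q₁ q₂ i j p : ℤ}
    (h : (∀ n, 0 ≤ n → eta q₁ i n = 0) ∨ (∀ n, 0 ≤ n → eta q₂ j n = 0)) :
    C q₁ q₂ p i j = 0 := by
  have h' : ∀ n, etaTilde q₁ q₂ n i j = 0 := by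
    intro n
    refine Finset.sum_eq_zero fun r hr => ?_
    rw [Finset.mem_Icc] at hr
    rcases h with h | h
    · rw [h r hr.1, zero_mul]
    · rw [h (n - r) (by omega), mul_zero]
  simp [C, h']

/-- The Clebsch-Gordan formula for the product of two weight vectors. -/
theorem EE_mul_EE {q₁ q₂ i j : ℤ} (h₁ : 0 ≤ q₁) (h₂ : 0 ≤ q₂) (hi : 0 ≤ i) (hj : 0 ≤ j) :
    EE q₁ i 0 * EE q₂ j 0 = ∑ p ∈ Finset.Icc 0 ((q₁ + q₂) / 2), C q₁ q₂ p i j •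
      EE (2 * p + (q₁ + q₂) % 2) (2 * p - sigma2 q₁ q₂ i j + (q₁ + q₂) % 2)
        ((q₁ + q₂) / 2 - p) := by
  lift q₁ to ℕ using h₁
  lift q₂ to ℕ using h₂
  lift i to ℕ using hi
  lift j to ℕ using hj
  obtain ⟨s₁, r₁, hr₁, rfl⟩ : ∃ s r : ℕ, r < 2 ∧ q₁ = 2 * s + r := ⟨q₁ / 2, q₁ % 2, by omega, by omega⟩
  obtain ⟨s₂, r₂, hr₂, rfl⟩ : ∃ s r : ℕ, r < 2 ∧ q₂ = 2 * s + r := ⟨q₂ / 2, q₂ % 2, by omega, by omega⟩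
  by_cases hi : s₁ + r₁ ≤ i
  · by_cases hj : s₂ + r₂ ≤ j
    · obtain ⟨f, ρ, hρ, hf⟩ : ∃ f ρ : ℕ, ρ < 2 ∧ 2 * f + ρ = r₁ + r₂ :=
        ⟨(r₁ + r₂) / 2, (r₁ + r₂) % 2, by omega, by omega⟩
      obtain ⟨c, hc⟩ : ∃ c : ℕ, c + s₁ + s₂ + r₁ + r₂ = i + j + f :=
        ⟨i + j + f - s₁ - s₂ - r₁ - r₂, by omega⟩
      have e1 := EE_natCast (2 * s₁ + r₁) i 0
      have e2 := EE_natCast (2 * s₂ + r₂) j 0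
      simp only [pow_zero, mul_one, Nat.cast_zero] at e1 e2
      rw [e1, e2, E_mul_E_natCast hr₁ hr₂ hi hj hf hρ rfl hc]
      have a1 : (((2 * s₁ + r₁ : ℕ) : ℤ) + (2 * s₂ + r₂ : ℕ)) / 2 = (s₁ + s₂ + f : ℕ) := by omega
      have a2 : (((2 * s₁ + r₁ : ℕ) : ℤ) + (2 * s₂ + r₂ : ℕ)) % 2 = ρ := by omega
      rw [a1, a2, sum_Icc_zero_natCast]
      symm
      rw [← Finset.sum_range_reflect]
      refine Finset.sum_congr rfl fun k hk => ?_
      have hk := Finset.mem_range.1 hk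
      have a3 : ((s₁ + s₂ + f + 1 - 1 - k : ℕ) : ℤ) = (s₁ + s₂ + f : ℕ) - k := by omega
      rw [a3]
      -- For k > c both weight vectors are out of range, so the value of C is immaterial.
      by_cases hkc : k ≤ c
      · have hC := C_natCast hr₁ hr₂ hf hρ rfl hc (k := k) (by omega) hkc
        push_cast at hC ⊢
        rw [← hC]
        congr 1
        congr 1
        · simp only [sigma2]; omega
        · ring
      · rw [EE_of_lt (by simp only [sigma2]; omega), EE_of_lt (by omega), smul_zero, smul_zero]
    · rw [EE_of_lt (q := (2 * s₂ + r₂ : ℕ)) (by omega), mul_zero]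
      refine (Finset.sum_eq_zero fun p _ => ?_).symm
      have : ∀ n, 0 ≤ n → eta (2 * s₂ + r₂ : ℕ) j n = 0 := by
        intro n hn
        lift n to ℕ using hn
        push_cast
        exact eta_eq_zero_of_lt hr₂ (by omega)
      rw [C_eq_zero (Or.inr this), zero_smul]
  · rw [EE_of_lt (q := (2 * s₁ + r₁ : ℕ)) (by omega), zero_mul]
    refine (Finset.sum_eq_zero fun p _ => ?_).symm
    have : ∀ n, 0 ≤ n → eta (2 * s₁ + r₁ : ℕ) i n = 0 := by
      intro n hn
      lift n to ℕ using hn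
      push_cast
      exact eta_eq_zero_of_lt hr₁ (by omega)
    rw [C_eq_zero (Or.inl this), zero_smul]

/-! ### Linear independence of weight vectors -/

theorem z_ne_zero : z ≠ 0 := by
  intro h
  have := dz_z
  rw [h, map_zero] at this
  exact zero_ne_one this

theorem Δ_ne_zero : Δ ≠ 0 := by
  intro h
  have : dx Δ = z := by simp [Δ, pow_two]
  rw [h, map_zero] at this
  exact z_ne_zero this.symm

theorem M_pow_EE (n : ℕ) (q i k : ℤ) :
    ((M : FPS →ₗ[ℝ] FPS) ^ n) (EE q i k) =
      (∏ t ∈ Finset.range n, ((q - t) * (2 * i - q + t + 1) : ℝ)) • EE (q - n) i k := by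
  induction n with
  | zero => simp
  | succ n ih =>
    rw [pow_succ', Module.End.mul_apply, ih, map_smul]
    have := M_EE (q - n) i k
    have e : q - (n + 1 : ℕ) = q - n - 1 := by push_cast; ring
    rw [Finset.prod_range_succ, e, mul_smul]
    congr 1
    refine this.trans ?_
    congr 1
    push_cast; ring

theorem M_pow_EE_ne_zero {q : ℕ} {i k : ℤ} (hi : q ≤ 2 * i) (hk : 0 ≤ k) :
    ((M : FPS →ₗ[ℝ] FPS) ^ q) (EE q i k) ≠ 0 := by
  lift i to ℕ using by omega
  lift k to ℕ using hk
  rw [M_pow_EE]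
  refine smul_ne_zero (Finset.prod_ne_zero_iff.2 fun t ht => ?_) ?_
  · have ht := Finset.mem_range.1 ht
    have h1 : ((q : ℤ) - t) ≠ 0 := by omega
    have h2 : (2 * i - q + t + 1 : ℤ) ≠ 0 := by omega
    exact mul_ne_zero (by exact_mod_cast h1) (by exact_mod_cast h2)
  · have := EE_natCast 0 i k
    push_cast at this
    rw [sub_self, this, E_zero]
    exact mul_ne_zero (pow_ne_zero _ z_ne_zero) (pow_ne_zero _ Δ_ne_zero)

/-- Weight vectors of distinct weights are linearly independent. -/
theorem EE_linearIndependent {ι : Type*} (s : Finset ι) (q i k : ι → ℤ) (w : ι → ℝ)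
    (hq : Set.InjOn q s) (h : ∑ j ∈ s, w j • EE (q j) (i j) (k j) = 0) :
    ∀ j ∈ s, w j • EE (q j) (i j) (k j) = 0 := by
  classical
  by_contra hne
  push Not at hne
  obtain ⟨j₁, hj₁, hne₁⟩ := hne
  -- Among the nonzero terms take the one with the largest q. M^q annihilates those with smaller q
  -- and maps this one to a nonzero multiple of z^i Δ^k.
  obtain ⟨j, hj, hmax⟩ := Finset.exists_max_image
    (s.filter fun j => w j • EE (q j) (i j) (k j) ≠ 0) q ⟨j₁, Finset.mem_filter.2 ⟨hj₁, hne₁⟩⟩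
  simp only [Finset.mem_filter] at hj hmax
  obtain ⟨hjs, hj⟩ := hj
  have hE : 0 ≤ q j ∧ q j ≤ 2 * i j ∧ 0 ≤ k j := by
    by_contra h'
    rw [EE, if_neg h', smul_zero] at hj
    exact hj rfl
  obtain ⟨n, hn⟩ := Int.eq_ofNat_of_zero_le hE.1
  have h' := congrArg ((M : FPS →ₗ[ℝ] FPS) ^ n) h
  rw [map_sum, map_zero, Finset.sum_eq_single j, hn, map_smul] at h'
  · have := M_pow_EE_ne_zero (q := n) (i := i j) (k := k j) (by omega) hE.2.2
    rcases smul_eq_zero.1 h' with h' | h'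
    · rw [h', zero_smul] at hj; exact hj rfl
    · exact this h'
  · intro t ht htj
    by_cases h0 : w t • EE (q t) (i t) (k t) = 0
    · rw [h0, map_zero]
    · have h1 := hmax t ⟨ht, h0⟩
      have h2 : q t ≠ q j := fun h => htj (hq ht hjs h)
      rw [map_smul, M_pow_EE, EE_of_neg (by omega), smul_zero, smul_zero]
  · intro h; exact absurd hjs h

theorem EE_ne_zero {q i k : ℤ} (hq : 0 ≤ q) (hi : q ≤ 2 * i) (hk : 0 ≤ k) : EE q i k ≠ 0 := by
  lift q to ℕ using hq
  intro h
  have := M_pow_EE_ne_zero hi hk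
  rw [h, map_zero] at this
  exact this rfl

/-! ### The components of the family `B` -/

theorem B_x {l i k : ℤ} (h1 : -1 ≤ l) (h2 : l ≤ 2 * i + 1) (h3 : 0 ≤ i) :
    B l i k x = ((2 * i - l + 1) / ((i + 1) * kappa (l + 2) (2 * i + 2)) : ℝ) •
      EE (l + 2) (i + 1) k := by
  rw [B_eq_ham h1 h2 h3, Derivation.smul_apply, ham_x, N_EE (by omega)]
  have e : l + 1 + 1 = l + 2 := by ring
  rw [e]
  -- Here l + 2 exceeds 2i + 2, where `kappa` takes its default value; the weight vector is zero
  -- anyway.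
  by_cases h : l = 2 * i + 1
  · rw [EE_of_lt (by omega), smul_zero, smul_zero]
  · have hk := kappa_succ (l := l + 1) (i := 2 * i + 2) (by omega) (by omega)
    have hpos := kappa_pos (l := l + 1) (i := 2 * i + 2) (by omega) (by omega)
    rw [e] at hk
    rw [hk]
    have hne : (2 * i + 2 - (l + 1) : ℝ) ≠ 0 := by
      have : (2 * i + 2 - (l + 1) : ℤ) ≠ 0 := by omega
      exact_mod_cast this
    congr 1
    push_cast
    have e2 : (2 * i - l + 1 : ℝ) = 2 * i + 2 - (l + 1) := by ring
    rw [e2, ← mul_assoc, div_mul_cancel_right₀ hne]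

theorem B_y {l i k : ℤ} (h1 : -1 ≤ l) (h2 : l ≤ 2 * i + 1) (h3 : 0 ≤ i) :
    B l i k y = ((i - l) / ((i + 1) * kappa (l + 1) (2 * i + 2)) : ℝ) •
      EE (l + 1) (i + 1) k := by
  rw [B_eq_ham h1 h2 h3, Derivation.smul_apply, ham_y, H_EE, smul_smul, ← neg_smul, smul_smul]
  congr 1
  push_cast
  ring

theorem B_z {l i k : ℤ} (h1 : -1 ≤ l) (h2 : l ≤ 2 * i + 1) (h3 : 0 ≤ i) :
    B l i k z = (-(l + 1) / ((i + 1) * kappa l (2 * i + 2)) : ℝ) • EE l (i + 1) k := by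
  rw [B_eq_ham h1 h2 h3, Derivation.smul_apply, ham_z, M_EE, ← neg_smul, smul_smul,
    add_sub_cancel_right, kappa_succ (by omega) (by omega)]
  congr 1
  push_cast
  have hne : (2 * i + 2 - l : ℝ) ≠ 0 := by
    have : (2 * i + 2 - l : ℤ) ≠ 0 := by omega
    exact_mod_cast this
  have hpos := (kappa_pos (l := l) (i := 2 * i + 2) (by omega) (by omega)).ne'
  have hi : (i + 1 : ℝ) ≠ 0 := by
    have : (i + 1 : ℤ) ≠ 0 := by omega
    exact_mod_cast this
  have e : (2 * (i + 1) - (l + 1) + 1 : ℝ) = 2 * i + 2 - l := by ring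
  rw [e]
  generalize (2 * i + 2 - l : ℝ) = t at hne ⊢
  field_simp

theorem B_Δ {l i k : ℤ} (h1 : -1 ≤ l) (h2 : l ≤ 2 * i + 1) (h3 : 0 ≤ i) : B l i k Δ = 0 := by
  rw [B_eq_ham h1 h2 h3, Derivation.smul_apply, ham_apply_antisymm]
  have : ham Δ = 0 := by simp [ham, N_Δ, M_Δ, H_Δ]
  simp [this]

theorem B_eq_zero {l i k : ℤ} (h : ¬(-1 ≤ l ∧ l ≤ 2 * i + 1 ∧ 0 ≤ i ∧ 0 ≤ k)) : B l i k = 0 :=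
  if_neg h

theorem B_apply_EE {l i : ℤ} {k₁ k₂ : ℕ} (h1 : -1 ≤ l) (h2 : l ≤ 2 * i + 1) (h3 : 0 ≤ i)
    (q j : ℤ) :
    B l i k₁ (EE q (j + 1) k₂) =
      (((2 * i - l + 1) / ((i + 1) * kappa (l + 2) (2 * i + 2)) * (q * (q - 1) * (j + 1)) : ℝ) •
          (EE (l + 2) (i + 1) 0 * EE (q - 2) j 0) +
        ((i - l) / ((i + 1) * kappa (l + 1) (2 * i + 2)) * (2 * q * (j + 1)) : ℝ) •
          (EE (l + 1) (i + 1) 0 * EE (q - 1) j 0) +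
        (-(l + 1) / ((i + 1) * kappa l (2 * i + 2)) * (j + 1) : ℝ) •
          (EE l (i + 1) 0 * EE q j 0)) * Δ ^ (k₁ + k₂) := by
  rw [EE_eq_mul_Δ_pow q, Derivation.leibniz, Derivation.leibniz_pow, B_Δ h1 h2 h3,
    FVF.apply_eq, B_x h1 h2 h3, B_y h1 h2 h3, B_z h1 h2 h3, dx_EE, dy_EE, dz_EE,
    EE_eq_mul_Δ_pow (l + 2), EE_eq_mul_Δ_pow (l + 1), EE_eq_mul_Δ_pow l]
  simp only [smul_zero, zero_add, smul_eq_mul, add_sub_cancel_right]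
  push_cast
  simp only [Algebra.smul_def, map_mul, pow_add, mul_zero, zero_add]
  ring

/-! ### Expansion of brackets -/

/-- The Clebsch-Gordan formula fails for negative powers of N, where C carries no meaning. Condition
`hr` restricts it to terms whose scalar survives; the scalars produced by differentiation vanish at
the offending indices. -/
theorem smul_EE_mul_EE_mul_Δ_pow {q₁ q₂ i j S ρ σ : ℤ} (hQ : q₁ + q₂ = 2 * S + ρ)
    (hρ : ρ = 0 ∨ ρ = 1) (hσ : q₁ + q₂ - i - j = σ) (hi : 0 ≤ i) (hj : 0 ≤ j) {r : ℝ}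
    (hr : r ≠ 0 → 0 ≤ q₁ ∧ 0 ≤ q₂) (k : ℕ) :
    (r • (EE q₁ i 0 * EE q₂ j 0)) * Δ ^ k = ∑ p ∈ Finset.Icc 0 S,
      (r * C q₁ q₂ p i j) • EE (2 * p + ρ) (2 * p - σ + ρ) (S + k - p) := by
  by_cases h0 : r = 0
  · simp [h0]
  obtain ⟨h1, h2⟩ := hr h0
  have e1 : (q₁ + q₂) / 2 = S := by omega
  have e2 : (q₁ + q₂) % 2 = ρ := by omega
  rw [EE_mul_EE h1 h2 hi hj, e1, e2, Finset.smul_sum, Finset.sum_mul]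
  refine Finset.sum_congr rfl fun p hp => ?_
  have hp := (Finset.mem_Icc.1 hp).2
  rw [smul_smul, smul_mul_assoc, EE_mul_Δ_pow (by omega), sigma2, hσ]
  congr 2; ring

theorem poch_two (a : ℝ) : poch a 1 2 = a * (a + 1) := by
  simp [poch, Finset.prod_range_succ]

theorem poch_three (a : ℝ) : poch a 1 3 = a * (a + 1) * (a + 2) := by
  simp [poch, Finset.prod_range_succ]

theorem sum_Icc_one_three {V : Type*} [AddCommMonoid V] (f : ℕ → V) :
    ∑ p ∈ Finset.Icc 1 3, f p = f 1 + f 2 + f 3 := by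
  simp [Finset.sum_Icc_succ_top]

theorem lThree_index_nonneg {q₁ q₂ i₁ i₂ : ℤ} (h₁ : -1 ≤ q₁) (h₂ : -1 ≤ q₂) {p : ℕ}
    (hp : p ∈ Finset.Icc 1 3) (h : lThree p q₁ q₂ i₁ i₂ ≠ 0) :
    0 ≤ q₁ + 3 - p ∧ 0 ≤ q₂ - 3 + p := by
  by_contra hneg
  apply h
  rw [Finset.mem_Icc] at hp
  obtain ⟨hp1, hp3⟩ := hp
  interval_cases p
  · have : q₂ = -1 ∨ q₂ = 0 ∨ q₂ = 1 := by push_cast at hneg; omega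
    rcases this with rfl | rfl | rfl <;> norm_num [lThree, poch_three]
  · have : q₂ = -1 ∨ q₂ = 0 := by push_cast at hneg; omega
    rcases this with rfl | rfl <;> simp [lThree, poch_two]
  · have : q₂ = -1 ∨ q₁ = -1 := by push_cast at hneg; omega
    rcases this with rfl | rfl <;> simp [lThree]

theorem lTwo_index_nonneg {q₁ q₂ i₁ i₂ : ℤ} (h₁ : -1 ≤ q₁) (h₂ : -1 ≤ q₂) {p : ℕ}
    (hp : p ∈ Finset.Icc 1 3) (h : lTwo p q₁ q₂ i₁ i₂ ≠ 0) :
    0 ≤ q₁ + 3 - p ∧ 0 ≤ q₂ - 2 + p := by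
  by_contra hneg
  apply h
  rw [Finset.mem_Icc] at hp
  obtain ⟨hp1, hp3⟩ := hp
  interval_cases p
  · have : q₂ = -1 ∨ q₂ = 0 := by push_cast at hneg; omega
    rcases this with rfl | rfl <;> simp [lTwo, poch_two]
  · have : q₂ = -1 := by push_cast at hneg; omega
    subst this; simp [lTwo]
  · have : q₁ = -1 := by push_cast at hneg; omega
    subst this; simp [lTwo]

section

variable {q₁ q₂ i₁ i₂ : ℤ} {k₁ k₂ : ℕ}

/-- The three values of p are the contributions of ∂x, ∂y and ∂z to the derivative of the
z-component. -/
theorem B_apply_B_z (h₁ : -1 ≤ q₁) (h₁' : q₁ ≤ 2 * i₁ + 1) (hi₁ : 0 ≤ i₁)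
    (h₂ : -1 ≤ q₂) (h₂' : q₂ ≤ 2 * i₂ + 1) (hi₂ : 0 ≤ i₂) {S d : ℤ} (hQ : q₁ + q₂ = 2 * S + d)
    (hd : d = 0 ∨ d = 1) :
    B q₁ i₁ k₁ (B q₂ i₂ k₂ z) = ∑ j ∈ Finset.Icc 0 S,
      (∑ p ∈ Finset.Icc 1 3, lThree p q₁ q₂ i₁ i₂ * C (q₁ + 3 - p) (q₂ - 3 + p) j (i₁ + 1) i₂) •
        EE (2 * j + d) (2 * j - (sigma2 q₁ q₂ i₁ i₂ - 1) + d) (S + (k₁ + k₂ : ℕ) - j) := by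
  have key : B q₁ i₁ k₁ (B q₂ i₂ k₂ z) = ∑ p ∈ Finset.Icc 1 3,
      (lThree p q₁ q₂ i₁ i₂ • (EE (q₁ + 3 - p) (i₁ + 1) 0 * EE (q₂ - 3 + p) i₂ 0)) *
        Δ ^ (k₁ + k₂) := by
    have hi : (i₂ + 1 : ℝ) ≠ 0 := by
      have : (i₂ + 1 : ℤ) ≠ 0 := by omega
      exact_mod_cast this
    rw [B_z h₂ h₂' hi₂, Derivation.map_smul, B_apply_EE h₁ h₁' hi₁, sum_Icc_one_three,
      ← add_mul, ← add_mul, ← smul_mul_assoc, smul_add, smul_add, smul_smul, smul_smul, smul_smul]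
    congr 1
    have e1 : q₁ + 3 - (1 : ℕ) = q₁ + 2 := by push_cast; ring
    have e2 : q₁ + 3 - (2 : ℕ) = q₁ + 1 := by push_cast; ring
    have e3 : q₁ + 3 - (3 : ℕ) = q₁ := by push_cast; ring
    have e4 : q₂ - 3 + (1 : ℕ) = q₂ - 2 := by push_cast; ring
    have e5 : q₂ - 3 + (2 : ℕ) = q₂ - 1 := by push_cast; ring
    have e6 : q₂ - 3 + (3 : ℕ) = q₂ := by push_cast; ring
    rw [e1, e2, e3, e4, e5, e6]
    simp only [lThree, poch_two, poch_three]
    refine congrArg₂ (· + ·) (congrArg₂ (· + ·) ?_ ?_) ?_ <;> refine congrArg (· • _) ?_ <;>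
      field_simp <;> ring
  rw [key]
  simp only [Finset.sum_smul]
  rw [Finset.sum_comm]
  refine Finset.sum_congr rfl fun p hp => ?_
  exact smul_EE_mul_EE_mul_Δ_pow (by rw [← hQ]; ring) hd (by simp only [sigma2]; ring) (by omega)
    hi₂ (lThree_index_nonneg h₁ h₂ hp) _

theorem B_apply_B_y (h₁ : -1 ≤ q₁) (h₁' : q₁ ≤ 2 * i₁ + 1) (hi₁ : 0 ≤ i₁)
    (h₂ : -1 ≤ q₂) (h₂' : q₂ ≤ 2 * i₂ + 1) (hi₂ : 0 ≤ i₂) {S : ℤ} (hQ : q₁ + q₂ + 1 = 2 * S) :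
    B q₁ i₁ k₁ (B q₂ i₂ k₂ y) = -∑ j ∈ Finset.Icc 0 S,
      (∑ p ∈ Finset.Icc 1 3, lTwo p q₁ q₂ i₁ i₂ * C (q₁ + 3 - p) (q₂ - 2 + p) j (i₁ + 1) i₂) •
        EE (2 * j) (2 * j - sigma2 q₁ q₂ i₁ i₂) (S + (k₁ + k₂ : ℕ) - j) := by
  have key : B q₁ i₁ k₁ (B q₂ i₂ k₂ y) = -∑ p ∈ Finset.Icc 1 3,
      (lTwo p q₁ q₂ i₁ i₂ • (EE (q₁ + 3 - p) (i₁ + 1) 0 * EE (q₂ - 2 + p) i₂ 0)) *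
        Δ ^ (k₁ + k₂) := by
    have hi : (i₂ + 1 : ℝ) ≠ 0 := by
      have : (i₂ + 1 : ℤ) ≠ 0 := by omega
      exact_mod_cast this
    rw [B_y h₂ h₂' hi₂, Derivation.map_smul, B_apply_EE h₁ h₁' hi₁, sum_Icc_one_three,
      ← add_mul, ← add_mul, ← smul_mul_assoc, smul_add, smul_add, smul_smul, smul_smul, smul_smul,
      ← neg_mul]
    have hneg : ∀ (a b c : ℝ) (u v w : FPS),
        -(a • u + b • v + c • w) = (-a) • u + (-b) • v + (-c) • w := by intros; module
    rw [hneg]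
    congr 1
    have e1 : q₁ + 3 - (1 : ℕ) = q₁ + 2 := by push_cast; ring
    have e2 : q₁ + 3 - (2 : ℕ) = q₁ + 1 := by push_cast; ring
    have e3 : q₁ + 3 - (3 : ℕ) = q₁ := by push_cast; ring
    have e4 : q₂ - 2 + (1 : ℕ) = q₂ + 1 - 2 := by push_cast; ring
    have e5 : q₂ - 2 + (2 : ℕ) = q₂ + 1 - 1 := by push_cast; ring
    have e6 : q₂ - 2 + (3 : ℕ) = q₂ + 1 := by push_cast; ring
    rw [e1, e2, e3, e4, e5, e6]
    simp only [lTwo, poch_two]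
    push_cast
    refine congrArg₂ (· + ·) (congrArg₂ (· + ·) ?_ ?_) ?_ <;> refine congrArg (· • _) ?_ <;>
      field_simp <;> ring
  rw [key]
  simp only [Finset.sum_smul]
  rw [Finset.sum_comm]
  congr 1
  refine Finset.sum_congr rfl fun p hp => ?_
  have := smul_EE_mul_EE_mul_Δ_pow (q₁ := q₁ + 3 - p) (q₂ := q₂ - 2 + p) (i := i₁ + 1) (j := i₂)
    (S := S) (ρ := 0) (σ := sigma2 q₁ q₂ i₁ i₂) (by linarith) (Or.inl rfl)
    (by simp only [sigma2]; ring) (by omega) hi₂ (lTwo_index_nonneg (i₁ := i₁) (i₂ := i₂) h₁ h₂ hp)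
    (k₁ + k₂)
  simpa using this

/-- The bracket of two members of the family is a combination of members of the family. -/
theorem exists_lie_B_eq_sum (h₁ : -1 ≤ q₁) (h₁' : q₁ ≤ 2 * i₁ + 1) (hi₁ : 0 ≤ i₁)
    (h₂ : -1 ≤ q₂) (h₂' : q₂ ≤ 2 * i₂ + 1) (hi₂ : 0 ≤ i₂) {S d : ℤ} (hQ : q₁ + q₂ = 2 * S + d)
    (hd : d = 0 ∨ d = 1) :
    ∃ c : ℤ → ℝ, ⁅B q₁ i₁ k₁, B q₂ i₂ k₂⁆ = ∑ j ∈ Finset.Icc (-1) S,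
      c j • B (2 * j + d) (2 * j - sigma2 q₁ q₂ i₁ i₂ + d) (S + (k₁ + k₂ : ℕ) - j) := by
  set σ := sigma2 q₁ q₂ i₁ i₂
  -- The powers of N in each product add up to q₁ + q₂ + 1 = 2(S + d) + (1 - d), which explains the
  -- bound S + d and the parity 1 - d.
  obtain ⟨c, hc⟩ : ∃ c : ℤ → ℝ, ham (EE (q₁ + 1) (i₁ + 1) k₁) (EE (q₂ + 1) (i₂ + 1) k₂) =
      ∑ p ∈ Finset.Icc 0 (S + d),
        c p • EE (2 * p + (1 - d)) (2 * p - σ + (1 - d)) (S + d + (k₁ + k₂ : ℕ) - p) := by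
    have hd' : 1 - d = 0 ∨ 1 - d = 1 := by omega
    rw [ham_EE_apply (by omega), sub_mul, sub_mul]
    have t1 := smul_EE_mul_EE_mul_Δ_pow (q₁ := q₁ + 1 + 1) (q₂ := q₂ + 1 - 2) (i := i₁ + 1)
      (j := i₂ + 1 - 1) (S := S + d) (ρ := 1 - d) (σ := σ)
      (r := ((q₂ + 1 : ℤ) * ((q₂ + 1 : ℤ) - 1) * (i₂ + 1 : ℤ) : ℝ)) (by linarith) hd'
      (by simp only [σ, sigma2]; ring) (by omega) (by omega) (by
        intro h
        have a1 : q₂ ≠ -1 := by rintro rfl; simp at h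
        have a2 : q₂ ≠ 0 := by rintro rfl; simp at h
        omega) (k₁ + k₂)
    have t2 := smul_EE_mul_EE_mul_Δ_pow (q₁ := q₁ + 1) (q₂ := q₂ + 1 - 1) (i := i₁ + 1)
      (j := i₂ + 1 - 1) (S := S + d) (ρ := 1 - d) (σ := σ)
      (r := (((q₁ + 1 : ℤ) - (i₁ + 1 : ℤ)) * (2 * (q₂ + 1 : ℤ) * (i₂ + 1 : ℤ)) : ℝ))
      (by linarith) hd'
      (by simp only [σ, sigma2]; ring) (by omega) (by omega) (by
        intro h
        have a1 : q₂ ≠ -1 := by rintro rfl; simp at h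
        omega) (k₁ + k₂)
    have t3 := smul_EE_mul_EE_mul_Δ_pow (q₁ := q₁ + 1 - 1) (q₂ := q₂ + 1) (i := i₁ + 1)
      (j := i₂ + 1 - 1) (S := S + d) (ρ := 1 - d) (σ := σ)
      (r := ((q₁ + 1 : ℤ) * (2 * (i₁ + 1 : ℤ) - (q₁ + 1 : ℤ) + 1) * (i₂ + 1 : ℤ) : ℝ))
      (by linarith) hd'
      (by simp only [σ, sigma2]; ring) (by omega) (by omega) (by
        intro h
        have a1 : q₁ ≠ -1 := by rintro rfl; simp at h
        omega) (k₁ + k₂)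
    rw [t1, t2, t3, ← Finset.sum_sub_distrib, ← Finset.sum_sub_distrib]
    simp only [← sub_smul]
    exact ⟨_, rfl⟩
  rw [B_eq_ham h₁ h₁' hi₁, B_eq_ham h₂ h₂' hi₂]
  set β₁ : ℝ := ((i₁ + 1) * kappa (q₁ + 1) (2 * i₁ + 2))⁻¹
  set β₂ : ℝ := ((i₂ + 1) * kappa (q₂ + 1) (2 * i₂ + 2))⁻¹
  have hl : ⁅β₁ • ham (EE (q₁ + 1) (i₁ + 1) k₁), β₂ • ham (EE (q₂ + 1) (i₂ + 1) k₂)⁆ =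
      (β₁ * β₂) • ham (ham (EE (q₁ + 1) (i₁ + 1) k₁) (EE (q₂ + 1) (i₂ + 1) k₂)) := by
    rw [← lie_ham_ham, mul_smul]
    exact (smul_lie (L := FVF) (M := FVF) β₁ _ _).trans
      (congrArg _ (lie_smul (L := FVF) (M := FVF) β₂ _ _))
  rw [hl, hc, ham_sum, Finset.smul_sum]
  refine ⟨fun j => β₁ * β₂ * (c (j + d) * ((2 * (j + d) - σ + (1 - d) - 1 : ℤ) + 1) *
    kappa (2 * (j + d) + (1 - d)) (2 * (2 * (j + d) - σ + (1 - d) - 1) + 2)), ?_⟩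
  -- The substitution p = j + d leaves j ≥ -d. If d = 0, the additional index j = -1 gives
  -- superscript -2, hence a zero field.
  have hsub : Finset.Icc (-d) S ⊆ Finset.Icc (-1) S := Finset.Icc_subset_Icc (by omega) le_rfl
  rw [← Finset.sum_subset hsub]
  · refine Finset.sum_nbij' (fun p => p - d) (fun j => j + d) ?_ ?_ ?_ ?_ ?_
    · intro p hp; simp only [Finset.mem_Icc] at *; omega
    · intro p hp; simp only [Finset.mem_Icc] at *; omega
    · intro p _; ring
    · intro p _; ring
    · intro p _
      have := ham_EE (2 * p + (1 - d) - 1) (2 * p - σ + (1 - d) - 1)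
        (S + d + (k₁ + k₂ : ℕ) - p)
      rw [sub_add_cancel, sub_add_cancel] at this
      beta_reduce
      rw [ham_smul, this, smul_smul, smul_smul, sub_add_cancel]
      congr 1
      · ring
      · congr 1 <;> ring
  · intro j hj hj'
    simp only [Finset.mem_Icc] at hj hj'
    rw [B_eq_zero (by omega), smul_zero]

end

/-! ### The structure constants -/

theorem FVF.sum_apply {ι : Type*} (s : Finset ι) (v : ι → FVF) (f : FPS) :
    (∑ i ∈ s, v i) f = ∑ i ∈ s, v i f :=
  map_sum (⟨⟨fun w : FVF => w f, rfl⟩, fun _ _ => rfl⟩ : FVF →+ FPS) v s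

theorem sum_Icc_zero_add_one {V : Type*} [AddCommMonoid V] (f : ℤ → V) (S : ℤ) :
    ∑ j ∈ Finset.Icc 0 (S + 1), f j = ∑ j ∈ Finset.Icc (-1) S, f (j + 1) := by
  refine Finset.sum_nbij' (fun j => j - 1) (fun j => j + 1) ?_ ?_ ?_ ?_ ?_
  · intro j hj; simp only [Finset.mem_Icc] at *; omega
  · intro j hj; simp only [Finset.mem_Icc] at *; omega
  · intro j _; ring
  · intro j _; ring
  · intro j _; simp

/-- Comparison of coefficients in expansions in weight vectors of distinct weights. -/
theorem EE_coeff_unique {s : Finset ℤ} {q i k : ℤ → ℤ} {u w : ℤ → ℝ} (hq : Set.InjOn q s)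
    (h : ∑ j ∈ s, u j • EE (q j) (i j) (k j) = ∑ j ∈ s, w j • EE (q j) (i j) (k j)) {j : ℤ}
    (hj : j ∈ s) (h₁ : 0 ≤ q j) (h₂ : q j ≤ 2 * i j) (h₃ : 0 ≤ k j) : u j = w j := by
  rw [← sub_eq_zero, ← Finset.sum_sub_distrib] at h
  simp only [← sub_smul] at h
  have := EE_linearIndependent s q i k _ hq h j hj
  rcases smul_eq_zero.1 this with h0 | h0
  · exact sub_eq_zero.1 h0
  · exact absurd h0 (EE_ne_zero h₁ h₂ h₃)

/-- An expansion with some coefficients c exists, and c j matters only if its B is in range. It is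
then read off from the z-component, whose scalar contains 2j + d + 1; if this factor is zero, so
that j = -1 and d = 1, the y-component serves instead. The powers of N involved are distinct for
distinct j. -/
theorem lie_B_eq_sum {q₁ q₂ i₁ i₂ : ℤ} (k₁ k₂ : ℕ) (h₁ : -1 ≤ q₁) (h₁' : q₁ ≤ 2 * i₁ + 1)
    (hi₁ : 0 ≤ i₁) (h₂ : -1 ≤ q₂) (h₂' : q₂ ≤ 2 * i₂ + 1) (hi₂ : 0 ≤ i₂) {S d : ℤ}
    (hQ : q₁ + q₂ = 2 * S + d) (hd : d = 0 ∨ d = 1) (hd' : |q₂ % 2 - q₁ % 2| = d) :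
    ⁅B q₁ i₁ k₁, B q₂ i₂ k₂⁆ = ∑ j ∈ Finset.Icc (-1) S, a q₁ q₂ j i₁ i₂ •
      B (2 * j + d) (2 * j - sigma2 q₁ q₂ i₁ i₂ + d) (S + (k₁ + k₂ : ℕ) - j) := by
  obtain ⟨c, hc⟩ := exists_lie_B_eq_sum (k₁ := k₁) (k₂ := k₂) h₁ h₁' hi₁ h₂ h₂' hi₂ hQ hd
  rw [hc]
  set σ := sigma2 q₁ q₂ i₁ i₂ with hσ
  have hσ' : sigma2 q₂ q₁ i₂ i₁ = σ := by simp only [hσ, sigma2]; ring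
  have hk : k₂ + k₁ = k₁ + k₂ := add_comm _ _
  refine Finset.sum_congr rfl fun j hj => ?_
  by_cases hB : -1 ≤ 2 * j + d ∧ 2 * j + d ≤ 2 * (2 * j - σ + d) + 1 ∧ 0 ≤ 2 * j - σ + d ∧
    0 ≤ S + (k₁ + k₂ : ℕ) - j
  swap
  · rw [B_eq_zero hB, smul_zero, smul_zero]
  congr 1
  obtain ⟨b1, b2, b3, b4⟩ := hB
  have hi : ((2 * j - σ + d : ℤ) + 1 : ℝ) ≠ 0 := by
    have : (2 * j - σ + d + 1 : ℤ) ≠ 0 := by omega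
    exact_mod_cast this
  by_cases hl : 2 * j + 1 + d = 0
  · obtain ⟨rfl, rfl⟩ : j = -1 ∧ d = 1 := by omega
    have hy := congrArg (fun v : FVF => v y) hc
    simp only [Derivation.commutator_apply] at hy
    -- The expansion of the y-component runs over 0, …, S + 1 and is shifted by one to match j; this
    -- is why C occurs with index 0 when j = -1.
    rw [B_apply_B_y h₁ h₁' hi₁ h₂ h₂' hi₂ (S := S + 1) (by omega),
      B_apply_B_y h₂ h₂' hi₂ h₁ h₁' hi₁ (S := S + 1) (by omega), hσ', ← hσ, hk,
      sub_neg_eq_add, neg_add_eq_sub, ← Finset.sum_sub_distrib, FVF.sum_apply,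
      sum_Icc_zero_add_one] at hy
    simp only [← sub_smul, ← Finset.sum_sub_distrib, Derivation.smul_apply] at hy
    have hBy : ∀ j, B (2 * j + 1) (2 * j - σ + 1) (S + (k₁ + k₂ : ℕ) - j) y =
        (if -1 ≤ 2 * j + 1 ∧ 2 * j + 1 ≤ 2 * (2 * j - σ + 1) + 1 ∧ 0 ≤ 2 * j - σ + 1 then
          (((2 * j - σ + 1 : ℤ) - (2 * j + 1 : ℤ)) / (((2 * j - σ + 1 : ℤ) + 1) *
            kappa (2 * j + 1 + 1) (2 * (2 * j - σ + 1) + 2)) : ℝ) else (0 : ℝ)) •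
          EE (2 * (j + 1)) (2 * (j + 1) - σ) (S + 1 + (k₁ + k₂ : ℕ) - (j + 1)) := by
      intro j
      split_ifs with h
      · rw [B_y h.1 h.2.1 h.2.2]
        congr 2 <;> ring
      · rw [B_eq_zero (by tauto)]; simp
    simp only [hBy, smul_smul] at hy
    have := EE_coeff_unique (fun i _ j _ h => by simpa using h) hy.symm hj (by norm_num) (by omega)
      (by omega)
    rw [if_pos ⟨b1, b2, b3⟩] at this
    have hκ : kappa (2 * (-1) + 1 + 1) (2 * (2 * (-1) - σ + 1) + 2) = 1 := by
      have : 0 ≤ 2 * (2 * (-1) - σ + 1) + 2 := by omega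
      rw [kappa, if_pos ⟨this, by omega⟩]
      norm_num
      exact Nat.factorial_ne_zero _
    have hκ' : kappa 0 (-2 * σ) = 1 := by
      have e : -2 * σ = 2 * (2 * (-1) - σ + 1) + 2 := by ring
      rw [e]; exact hκ
    have hone : ((2 * (-1) - σ + 1 : ℤ) - (2 * (-1) + 1 : ℤ) : ℝ) /
        (((2 * (-1) - σ + 1 : ℤ) + 1) * 1) = 1 := by
      rw [mul_one, div_eq_one_iff_eq hi]; push_cast; ring
    rw [hκ, hone, mul_one] at this
    unfold a
    simp only [abs_sub_comm (q₁ % 2), hd', ← hσ, hκ']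
    rw [if_neg (by omega)]
    simpa using this
  · have hz := congrArg (fun v : FVF => v z) hc
    simp only [Derivation.commutator_apply] at hz
    rw [B_apply_B_z h₁ h₁' hi₁ h₂ h₂' hi₂ hQ hd,
      B_apply_B_z h₂ h₂' hi₂ h₁ h₁' hi₁ (S := S) (d := d) (by omega) hd, hσ', ← hσ, hk,
      ← Finset.sum_sub_distrib, FVF.sum_apply] at hz
    simp only [← sub_smul, ← Finset.sum_sub_distrib, Derivation.smul_apply] at hz
    rw [Finset.sum_subset (Finset.Icc_subset_Icc_left (show (-1 : ℤ) ≤ 0 by norm_num))] at hz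
    swap
    · intro j hj hj'
      simp only [Finset.mem_Icc] at hj hj'
      rw [EE_of_neg (by omega), smul_zero]
    have hBz : ∀ j, B (2 * j + d) (2 * j - σ + d) (S + (k₁ + k₂ : ℕ) - j) z =
        (if -1 ≤ 2 * j + d ∧ 2 * j + d ≤ 2 * (2 * j - σ + d) + 1 ∧ 0 ≤ 2 * j - σ + d then
          (-((2 * j + d : ℤ) + 1) / (((2 * j - σ + d : ℤ) + 1) *
            kappa (2 * j + d) (2 * (2 * j - σ + d) + 2)) : ℝ) else (0 : ℝ)) •
          EE (2 * j + d) (2 * j - (σ - 1) + d) (S + (k₁ + k₂ : ℕ) - j) := by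
      intro j
      split_ifs with h
      · rw [B_z h.1 h.2.1 h.2.2]
        congr 2; ring
      · rw [B_eq_zero (by tauto)]; simp
    simp only [hBz, smul_smul] at hz
    have := EE_coeff_unique (fun i _ j _ h => by simpa using h) hz.symm hj (by omega) (by omega)
      (by omega)
    rw [if_pos ⟨b1, b2, b3⟩] at this
    unfold a
    simp only [hd', ← hσ]
    rw [if_pos hl]
    have hκ := kappa_pos (l := 2 * j + d) (i := 2 * (2 * j - σ + d) + 2) (by omega) (by omega)
    have e : 4 * j - 2 * σ + 2 + 2 * d = 2 * (2 * j - σ + d) + 2 := by ring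
    have hl' : (2 * j + d + 1 : ℝ) ≠ 0 := by
      have : (2 * j + d + 1 : ℤ) ≠ 0 := by omega
      exact_mod_cast this
    have hneg : ∑ p ∈ Finset.Icc 1 3,
        (lThree p q₂ q₁ i₂ i₁ * C (q₂ + 3 - p) (q₁ - 3 + p) j (i₂ + 1) i₁ -
          lThree p q₁ q₂ i₁ i₂ * C (q₁ + 3 - p) (q₂ - 3 + p) j (i₁ + 1) i₂) =
        -∑ p ∈ Finset.Icc 1 3,
        (lThree p q₁ q₂ i₁ i₂ * C (q₁ + 3 - p) (q₂ - 3 + p) j (i₁ + 1) i₂ -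
          lThree p q₂ q₁ i₂ i₁ * C (q₂ + 3 - p) (q₁ - 3 + p) j (i₂ + 1) i₁) := by
      rw [← Finset.sum_neg_distrib]
      exact Finset.sum_congr rfl fun p _ => by ring
    rw [hneg, ← this, e]
    push_cast at hi ⊢
    have e' : (2 * j + 1 - σ + d : ℝ) = 2 * j - σ + d + 1 := by ring
    rw [e']
    generalize (2 * j - σ + d + 1 : ℝ) = t at hi ⊢
    generalize (2 * j + d + 1 : ℝ) = t' at hl' ⊢
    field_simp

theorem lie_B_eq_sum_Icc {q₁ q₂ s₁ s₂ r₁ r₂ i₁ i₂ k₁ k₂ : ℤ} (hi₁ : 0 ≤ i₁) (hi₂ : 0 ≤ i₂)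
    (hk₁ : 0 ≤ k₁) (hk₂ : 0 ≤ k₂) (h₁ : -1 ≤ q₁) (h₁' : q₁ ≤ 2 * i₁ + 1)
    (h₂ : -1 ≤ q₂) (h₂' : q₂ ≤ 2 * i₂ + 1) (hq₁ : q₁ = 2 * s₁ + r₁) (hr₁ : r₁ = 0 ∨ r₁ = 1)
    (hq₂ : q₂ = 2 * s₂ + r₂) (hr₂ : r₂ = 0 ∨ r₂ = 1) :
    ⁅B q₁ i₁ k₁, B q₂ i₂ k₂⁆ =
      ∑ j ∈ Finset.Icc (max (sigma2 q₁ q₂ i₁ i₂ - 1) (-1)) (s₁ + s₂ + (r₁ + r₂) / 2),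
        a q₁ q₂ j i₁ i₂ •
          B (2 * j + |r₂ - r₁|) (2 * j - sigma2 q₁ q₂ i₁ i₂ + |r₂ - r₁|)
            (sigma1 s₁ s₂ k₁ k₂ - j + (r₁ + r₂) / 2) := by
  lift k₁ to ℕ using hk₁
  lift k₂ to ℕ using hk₂
  have hd : |r₂ - r₁| = 0 ∨ |r₂ - r₁| = 1 := by
    rcases hr₁ with rfl | rfl <;> rcases hr₂ with rfl | rfl <;> simp
  have hQ : q₁ + q₂ = 2 * (s₁ + s₂ + (r₁ + r₂) / 2) + |r₂ - r₁| := by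
    rcases hr₁ with rfl | rfl <;> rcases hr₂ with rfl | rfl <;> simp <;> omega
  have hd' : |q₂ % 2 - q₁ % 2| = |r₂ - r₁| := by
    rw [show q₂ % 2 = r₂ by omega, show q₁ % 2 = r₁ by omega]
  rw [lie_B_eq_sum k₁ k₂ h₁ h₁' hi₁ h₂ h₂' hi₂ hQ hd hd']
  rw [← Finset.sum_subset (Finset.Icc_subset_Icc_left (le_max_right _ _))]
  · refine Finset.sum_congr rfl fun j _ => ?_
    congr 2
    simp only [sigma1]; push_cast; ring
  -- For j < σ₂ - 1 the superscript exceeds its upper bound, so the omitted fields are zero.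
  · intro j hj hj'
    simp only [Finset.mem_Icc] at hj hj'
    rw [B_eq_zero (by omega), smul_zero]

/-! ### Homogeneity -/

/-- Homogeneous power series of degree `n`. -/
def homogeneous (n : ℕ) : Submodule ℝ FPS where
  carrier := {f | ∀ d, d.degree ≠ n → MvPowerSeries.coeff d f = 0}
  zero_mem' := fun _ _ => by simp
  add_mem' := fun hf hg d hd => by rw [map_add, hf d hd, hg d hd, add_zero]
  smul_mem' := fun r f hf d hd => by rw [MvPowerSeries.coeff_smul, hf d hd, mul_zero]

theorem mul_mem_homogeneous {f g : FPS} {m n : ℕ} (hf : f ∈ homogeneous m)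
    (hg : g ∈ homogeneous n) : f * g ∈ homogeneous (m + n) := by
  classical
  intro d hd
  rw [MvPowerSeries.coeff_mul]
  refine Finset.sum_eq_zero fun p hp => ?_
  rw [Finset.HasAntidiagonal.mem_antidiagonal] at hp
  by_cases h : p.1.degree = m
  · rw [hg p.2 (fun h' => hd (by rw [← hp, map_add, h, h'])), mul_zero]
  · rw [hf p.1 h, zero_mul]

theorem pderiv_mem_homogeneous {f : FPS} {n : ℕ} (hf : f ∈ homogeneous (n + 1)) (b : Fin 3) :
    MvPowerSeries.pderiv ℝ b f ∈ homogeneous n := by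
  intro d hd
  rw [MvPowerSeries.coeff_pderiv, hf, zero_mul]
  simpa [map_add] using hd

theorem X_mem_homogeneous (b : Fin 3) : (MvPowerSeries.X b : FPS) ∈ homogeneous 1 := by
  classical
  intro d hd
  rw [MvPowerSeries.coeff_X, if_neg]
  rintro rfl
  simp at hd

theorem pow_mem_homogeneous {f : FPS} {n : ℕ} (hf : f ∈ homogeneous n) (k : ℕ) :
    f ^ k ∈ homogeneous (n * k) := by
  induction k with
  | zero =>
    classical
    intro d hd
    rw [pow_zero, MvPowerSeries.coeff_one, if_neg]
    rintro rfl
    simp at hd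
  | succ k ih => rw [pow_succ, mul_add, mul_one]; exact mul_mem_homogeneous ih hf

theorem N_mem_homogeneous {f : FPS} {n : ℕ} (hf : f ∈ homogeneous (n + 1)) :
    N f ∈ homogeneous (n + 1) := by
  have h : N f = x * dy f + ((y + y) * dz f) := by simp [N, two_mul]
  rw [h, add_comm n 1]
  have hy := X_mem_homogeneous 1
  exact Submodule.add_mem _ (mul_mem_homogeneous (X_mem_homogeneous 0) (pderiv_mem_homogeneous hf 1))
    (mul_mem_homogeneous (Submodule.add_mem _ hy hy) (pderiv_mem_homogeneous hf 2))

theorem E_mem_homogeneous (n i : ℕ) : E n (i + 1) ∈ homogeneous (i + 1) := by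
  induction n with
  | zero => simpa [z] using pow_mem_homogeneous (X_mem_homogeneous 2) (i + 1)
  | succ n ih => rw [← N_E]; exact N_mem_homogeneous ih

theorem Δ_mem_homogeneous : Δ ∈ homogeneous 2 :=
  Submodule.sub_mem _ (mul_mem_homogeneous (X_mem_homogeneous 0) (X_mem_homogeneous 2))
    (pow_mem_homogeneous (X_mem_homogeneous 1) 2)

theorem EE_mem_homogeneous (q : ℤ) (i k : ℕ) : EE q (i + 1) k ∈ homogeneous (i + 2 * k + 1) := by
  unfold EE
  split_ifs
  · have h : i + 2 * k + 1 = i + 1 + 2 * k := by ring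
    have h' : (i + 1 : ℤ).toNat = i + 1 := by omega
    rw [h, h']
    exact mul_mem_homogeneous (E_mem_homogeneous _ i) (pow_mem_homogeneous Δ_mem_homogeneous k)
  · exact Submodule.zero_mem _

theorem B_mem_homogeneous {l : ℤ} {i k : ℕ} (h₁ : -1 ≤ l) (h₂ : l ≤ 2 * i + 1) (b : Fin 3) :
    B l i k (MvPowerSeries.X b) ∈ homogeneous (i + 2 * k + 1) := by
  have h3 := Int.natCast_nonneg i
  fin_cases b
  · exact (B_x (k := k) h₁ h₂ h3).symm ▸ Submodule.smul_mem _ _ (EE_mem_homogeneous _ i k)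
  · exact (B_y (k := k) h₁ h₂ h3).symm ▸ Submodule.smul_mem _ _ (EE_mem_homogeneous _ i k)
  · exact (B_z (k := k) h₁ h₂ h3).symm ▸ Submodule.smul_mem _ _ (EE_mem_homogeneous _ i k)

/-! ### Bilinearity of the bracket -/

section Bracket

variable (u v w : FVF) (r : ℝ)

theorem FVF.lie_add : ⁅u, v + w⁆ = ⁅u, v⁆ + ⁅u, w⁆ := _root_.lie_add u v w
theorem FVF.add_lie : ⁅u + v, w⁆ = ⁅u, w⁆ + ⁅v, w⁆ := _root_.add_lie u v w
theorem FVF.lie_sub : ⁅u, v - w⁆ = ⁅u, v⁆ - ⁅u, w⁆ := _root_.lie_sub u v w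
theorem FVF.sub_lie : ⁅u - v, w⁆ = ⁅u, w⁆ - ⁅v, w⁆ := _root_.sub_lie u v w
theorem FVF.lie_zero : ⁅u, (0 : FVF)⁆ = 0 := _root_.lie_zero u
theorem FVF.zero_lie : ⁅(0 : FVF), u⁆ = 0 := _root_.zero_lie u
theorem FVF.lie_smul : ⁅u, r • v⁆ = r • ⁅u, v⁆ := _root_.lie_smul r u v
theorem FVF.smul_lie : ⁅r • u, v⁆ = r • ⁅u, v⁆ := _root_.smul_lie r u v
theorem FVF.lie_self : ⁅u, u⁆ = 0 := _root_.lie_self u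
theorem FVF.lie_skew : ⁅u, v⁆ = -⁅v, u⁆ := (_root_.lie_skew u v).symm

end Bracket

/-! ### The filtration by order -/

/-- The vector fields all of whose components have order at least `n`. -/
def orderGE (n : ℕ) : Submodule ℝ FVF where
  carrier := {v | ∀ b, (n : ℕ∞) ≤ (v (MvPowerSeries.X b)).order}
  zero_mem' := by intro b; simp
  add_mem' := fun hv hw b => (le_min (hv b) (hw b)).trans MvPowerSeries.min_order_le_add
  smul_mem' := fun _ _ hv b => (hv b).trans MvPowerSeries.le_order_smul

theorem mem_orderGE_iff {n : ℕ} {v : FVF} : v ∈ orderGE n ↔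
    ∀ b d, d.degree < n → MvPowerSeries.coeff d (v (MvPowerSeries.X b)) = 0 := by
  constructor
  · intro h b d hd
    exact MvPowerSeries.coeff_of_lt_order (lt_of_lt_of_le (by exact_mod_cast hd) (h b))
  · intro h b
    exact MvPowerSeries.nat_le_order fun d hd => h b d hd

theorem orderGE_anti {m n : ℕ} (h : m ≤ n) : orderGE n ≤ orderGE m :=
  fun _ hv b => le_trans (by exact_mod_cast h) (hv b)

theorem le_order_pderiv {n : ℕ} {f : FPS} (hf : ((n + 1 : ℕ) : ℕ∞) ≤ f.order) (b : Fin 3) :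
    (n : ℕ∞) ≤ (MvPowerSeries.pderiv ℝ b f).order := by
  refine MvPowerSeries.nat_le_order fun d hd => ?_
  rw [MvPowerSeries.coeff_pderiv, MvPowerSeries.coeff_of_lt_order, zero_mul]
  refine lt_of_lt_of_le ?_ hf
  have : (d + Finsupp.single b 1).degree < n + 1 := by simpa [map_add] using hd
  exact_mod_cast this

theorem le_order_apply {m n : ℕ} {v : FVF} {f : FPS} (hv : v ∈ orderGE m)
    (hf : ((n + 1 : ℕ) : ℕ∞) ≤ f.order) : ((m + n : ℕ) : ℕ∞) ≤ (v f).order := by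
  rw [FVF.apply_eq]
  have h : ∀ b, ((m + n : ℕ) : ℕ∞) ≤
      (v (MvPowerSeries.X b) * MvPowerSeries.pderiv ℝ b f).order := fun b => by
    push_cast
    exact (add_le_add (hv b) (le_order_pderiv hf b)).trans MvPowerSeries.le_order_mul
  exact (le_min ((le_min (h 0) (h 1)).trans MvPowerSeries.min_order_le_add) (h 2)).trans
    MvPowerSeries.min_order_le_add

theorem lie_mem_orderGE {m n : ℕ} {v w : FVF} (hv : v ∈ orderGE (m + 1)) (hw : w ∈ orderGE (n + 1)) :
    ⁅v, w⁆ ∈ orderGE (m + n + 1) := by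
  intro b
  rw [Derivation.commutator_apply, sub_eq_add_neg]
  have h1 := le_order_apply hv (hw b)
  have h2 := le_order_apply hw (hv b)
  rw [← MvPowerSeries.order_neg] at h2
  have e1 : m + 1 + n = m + n + 1 := by ring
  have e2 : n + 1 + m = m + n + 1 := by ring
  rw [e1] at h1
  rw [e2] at h2
  exact (le_min h1 h2).trans MvPowerSeries.min_order_le_add

theorem B_mem_orderGE {l : ℤ} {i k : ℕ} (h₁ : -1 ≤ l) (h₂ : l ≤ 2 * i + 1) :
    B l i k ∈ orderGE (i + 2 * k + 1) := by
  rw [mem_orderGE_iff]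
  intro b d hd
  exact B_mem_homogeneous h₁ h₂ b d hd.ne

/-! ### Formal sums of the nonlinear members of the family -/

/-- The nonlinear members of the family. -/
def NonlinearIndex.toFVF (t : NonlinearIndex) : FVF := B t.l t.i t.k

/-- The degree of homogeneity. -/
def NonlinearIndex.deg (t : NonlinearIndex) : ℕ := t.i + 2 * t.k + 1

/-- Finite linear combinations of the nonlinear members of the family. -/
def nonlinearSpan : Submodule ℝ FVF := Submodule.span ℝ (Set.range NonlinearIndex.toFVF)

theorem B_mem_nonlinearSpan {l i k : ℤ} (h : 0 < i + 2 * k) : B l i k ∈ nonlinearSpan := by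
  by_cases hB : -1 ≤ l ∧ l ≤ 2 * i + 1 ∧ 0 ≤ i ∧ 0 ≤ k
  · obtain ⟨h1, h2, h3, h4⟩ := hB
    lift i to ℕ using h3
    lift k to ℕ using h4
    exact Submodule.subset_span ⟨⟨l, i, k, h1, h2, by omega⟩, rfl⟩
  · rw [B_eq_zero hB]; exact Submodule.zero_mem _

/-- Every B on the right of the expansion has i + 2k = i₁ + i₂ + 2k₁ + 2k₂. One nonlinear factor
makes this positive, so the bracket with B^1_{0,0} is covered as well. -/
theorem lie_B_mem_nonlinearSpan {q₁ q₂ : ℤ} {i₁ i₂ k₁ k₂ : ℕ} (h₁ : -1 ≤ q₁)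
    (h₁' : q₁ ≤ 2 * i₁ + 1) (h₂ : -1 ≤ q₂) (h₂' : q₂ ≤ 2 * i₂ + 1) (h : i₂ ≠ 0 ∨ k₂ ≠ 0) :
    ⁅B q₁ i₁ k₁, B q₂ i₂ k₂⁆ ∈ nonlinearSpan := by
  obtain ⟨c, hc⟩ := exists_lie_B_eq_sum (k₁ := k₁) (k₂ := k₂) h₁ h₁' (Int.natCast_nonneg i₁) h₂ h₂'
    (Int.natCast_nonneg i₂) (S := (q₁ + q₂) / 2) (d := (q₁ + q₂) % 2) (by omega) (by omega)
  rw [hc]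
  refine Submodule.sum_mem _ fun j _ => Submodule.smul_mem _ _ (B_mem_nonlinearSpan ?_)
  simp only [sigma2]
  omega

theorem lie_linear_mem_nonlinearSpan {u : FVF} (hu : u ∈ nonlinearSpan) :
    ⁅B 1 0 0, u⁆ ∈ nonlinearSpan := by
  induction hu using Submodule.span_induction with
  | mem u hu =>
    obtain ⟨t, rfl⟩ := hu
    have := lie_B_mem_nonlinearSpan (q₁ := 1) (i₁ := 0) (k₁ := 0) (by norm_num) (by norm_num)
      t.neg_one_le t.le_two_mul t.nonlinear
    simpa [NonlinearIndex.toFVF] using this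
  | zero => rw [FVF.lie_zero]; exact Submodule.zero_mem _
  | add u w _ _ hu hw => rw [FVF.lie_add]; exact Submodule.add_mem _ hu hw
  | smul r u _ hu =>
    rw [FVF.lie_smul]; exact Submodule.smul_mem _ _ hu

theorem lie_mem_nonlinearSpan {u w : FVF} (hu : u ∈ nonlinearSpan) (hw : w ∈ nonlinearSpan) :
    ⁅u, w⁆ ∈ nonlinearSpan := by
  induction hu, hw using Submodule.span_induction₂ with
  | mem_mem u w hu hw =>
    obtain ⟨t, rfl⟩ := hu
    obtain ⟨t', rfl⟩ := hw
    exact lie_B_mem_nonlinearSpan t.neg_one_le t.le_two_mul t'.neg_one_le t'.le_two_mul t'.nonlinear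
  | zero_left w _ => rw [FVF.zero_lie]; exact Submodule.zero_mem _
  | zero_right w _ => rw [FVF.lie_zero]; exact Submodule.zero_mem _
  | add_left u v w _ _ _ h₁ h₂ => rw [FVF.add_lie]; exact Submodule.add_mem _ h₁ h₂
  | add_right u v w _ _ _ h₁ h₂ => rw [FVF.lie_add]; exact Submodule.add_mem _ h₁ h₂
  | smul_left r u w _ _ h => rw [FVF.smul_lie]; exact Submodule.smul_mem _ _ h
  | smul_right r u w _ _ h => rw [FVF.lie_smul]; exact Submodule.smul_mem _ _ h

theorem nonlinearSpan_le_orderGE : nonlinearSpan ≤ orderGE 1 := by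
  refine Submodule.span_le.2 ?_
  rintro _ ⟨t, rfl⟩
  exact orderGE_anti (by omega) (B_mem_orderGE t.neg_one_le t.le_two_mul)

/-- The closure of the span of the nonlinear members of the family in the adic topology. -/
def nonlinearClosure : Submodule ℝ FVF where
  carrier := {v | ∀ n, ∃ u ∈ nonlinearSpan, v - u ∈ orderGE (n + 1)}
  zero_mem' := fun _ => ⟨0, Submodule.zero_mem _, by rw [sub_zero]; exact Submodule.zero_mem _⟩
  add_mem' := by
    intro v w hv hw n
    obtain ⟨u, hu, hvu⟩ := hv n
    obtain ⟨u', hu', hwu⟩ := hw n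
    refine ⟨u + u', Submodule.add_mem _ hu hu', ?_⟩
    rw [add_sub_add_comm]
    exact Submodule.add_mem _ hvu hwu
  smul_mem' := by
    intro r v hv n
    obtain ⟨u, hu, hvu⟩ := hv n
    refine ⟨r • u, Submodule.smul_mem _ _ hu, ?_⟩
    rw [← smul_sub]
    exact Submodule.smul_mem _ _ hvu

theorem lie_linear_mem_nonlinearClosure {v : FVF} (hv : v ∈ nonlinearClosure) :
    ⁅B 1 0 0, v⁆ ∈ nonlinearClosure := by
  intro n
  obtain ⟨u, hu, hvu⟩ := hv n
  refine ⟨_, lie_linear_mem_nonlinearSpan hu, ?_⟩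
  rw [← FVF.lie_sub]
  have h := B_mem_orderGE (l := 1) (i := 0) (k := 0) (by norm_num) (by norm_num)
  have := lie_mem_orderGE (m := 0) h hvu
  simpa using this

theorem lie_mem_nonlinearClosure {v w : FVF} (hv : v ∈ nonlinearClosure)
    (hw : w ∈ nonlinearClosure) : ⁅v, w⁆ ∈ nonlinearClosure := by
  intro n
  obtain ⟨u, hu, hvu⟩ := hv n
  obtain ⟨u', hu', hwu⟩ := hw n
  refine ⟨_, lie_mem_nonlinearSpan hu hu', ?_⟩
  -- One factor of each bracket on the right has order at least n + 1 and the other at least 1, so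
  -- the order n + 1 is preserved.
  have e : ⁅v, w⁆ - ⁅u, u'⁆ = ⁅v - u, w⁆ + ⁅u, w - u'⁆ := by
    rw [FVF.sub_lie, FVF.lie_sub]; abel
  have hw1 : w ∈ orderGE (0 + 1) := by
    have := Submodule.add_mem _ (orderGE_anti (Nat.le_add_left _ _) hwu)
      (nonlinearSpan_le_orderGE hu')
    simpa using this
  rw [e]
  refine Submodule.add_mem _ ?_ ?_
  · exact lie_mem_orderGE hvu hw1
  · have := lie_mem_orderGE (m := 0) (nonlinearSpan_le_orderGE hu) hwu
    simpa using this

theorem finite_setOf_degree_lt (n : ℕ) : {d : Fin 3 →₀ ℕ | d.degree < n}.Finite := by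
  refine (Set.finite_Iic (Finsupp.equivFunOnFinite.symm fun _ => n)).subset fun d hd b => ?_
  exact (Finsupp.le_degree b d).trans hd.le

/-- Only finitely many monomials have degree at most n, so one finite partial sum agrees with w on
all of them. -/
theorem mem_nonlinearClosure_of_isFormalSum {b : NonlinearIndex → ℝ} {w : FVF}
    (h : IsFormalSum (fun t => b t • B t.l t.i t.k) w) : w ∈ nonlinearClosure := by
  intro n
  have h' : ∀ᶠ S : Finset NonlinearIndex in atTop, ∀ a : Fin 3, ∀ d ∈ {d | d.degree < n + 1},
      MvPowerSeries.coeff d ((∑ t ∈ S, b t • B t.l t.i t.k) (MvPowerSeries.X a)) =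
      MvPowerSeries.coeff d (w (MvPowerSeries.X a)) :=
    eventually_all.2 fun a => (eventually_all_finite (finite_setOf_degree_lt _)).2 fun d _ => h a d
  obtain ⟨S, hS⟩ := h'.exists
  refine ⟨∑ t ∈ S, b t • B t.l t.i t.k, Submodule.sum_mem _ fun t _ =>
    Submodule.smul_mem _ _ (Submodule.subset_span ⟨t, rfl⟩), ?_⟩
  rw [mem_orderGE_iff]
  intro a d hd
  rw [Derivation.sub_apply, map_sub, hS a d hd, sub_self]

/-- The finite approximations of w need not have compatible coefficients. By homogeneity a monomial
of degree n sees only the members of degree n, so it suffices to take the coefficient of each member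
from the approximation belonging to its own degree. -/
theorem exists_isFormalSum {w : FVF} (h : w ∈ nonlinearClosure) :
    ∃ b : NonlinearIndex → ℝ, IsFormalSum (fun t => b t • B t.l t.i t.k) w := by
  have h' : ∀ n, ∃ c : NonlinearIndex →₀ ℝ,
      w - c.sum (fun t r => r • t.toFVF) ∈ orderGE (n + 1) := by
    intro n
    obtain ⟨u, hu, hwu⟩ := h n
    obtain ⟨c, rfl⟩ := Finsupp.mem_span_range_iff_exists_finsupp.1 hu
    exact ⟨c, hwu⟩
  choose c hc using h'
  refine ⟨fun t => c t.deg t, fun a d => ?_⟩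
  filter_upwards [eventually_ge_atTop (c d.degree).support] with S hS
  have hw := mem_orderGE_iff.1 (hc d.degree) a d (Nat.lt_succ_self _)
  rw [Derivation.sub_apply, map_sub, sub_eq_zero] at hw
  rw [hw, Finsupp.sum, FVF.sum_apply, FVF.sum_apply, map_sum, map_sum]
  symm
  refine (Finset.sum_subset hS fun t _ ht => ?_).trans (Finset.sum_congr rfl fun t _ => ?_)
  · rw [Finsupp.notMem_support_iff.1 ht]; simp
  · by_cases hd : d.degree = t.deg
    · rw [hd]; rfl
    · have h0 : MvPowerSeries.coeff d (B t.l t.i t.k (MvPowerSeries.X a)) = 0 :=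
        B_mem_homogeneous t.neg_one_le t.le_two_mul a d hd
      simp [NonlinearIndex.toFVF, h0]

/-- The zero formal sum puts B^1_{0,0} into 𝓑, and subtracting it leaves all formal sums of
nonlinear members; these are exactly the closure. -/
theorem scriptB_eq : scriptB = Submodule.span ℝ {B 1 0 0} ⊔ nonlinearClosure := by
  have hB : B 1 0 0 ∈ scriptB := by
    obtain ⟨b, hb⟩ := exists_isFormalSum (Submodule.zero_mem nonlinearClosure)
    exact Submodule.subset_span ⟨b, 0, hb, by rw [add_zero]⟩
  apply le_antisymm
  · refine Submodule.span_le.2 ?_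
    rintro _ ⟨b, w, hw, rfl⟩
    exact Submodule.add_mem_sup (Submodule.mem_span_singleton_self _)
      (mem_nonlinearClosure_of_isFormalSum hw)
  · refine sup_le (by simpa using hB) fun w hw => ?_
    obtain ⟨b, hb⟩ := exists_isFormalSum hw
    have : B 1 0 0 + w ∈ scriptB := Submodule.subset_span ⟨b, w, hb, rfl⟩
    simpa using Submodule.sub_mem _ this hB

/-- Since B^1_{0,0} commutes with itself, the bracket already lies in the nonlinear closure. -/
theorem lie_mem_scriptB {v w : FVF} (hv : v ∈ scriptB) (hw : w ∈ scriptB) : ⁅v, w⁆ ∈ scriptB := by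
  rw [scriptB_eq] at *
  obtain ⟨_, hr, v, hv', rfl⟩ := Submodule.mem_sup.1 hv
  obtain ⟨r, rfl⟩ := Submodule.mem_span_singleton.1 hr
  obtain ⟨_, hr', w, hw', rfl⟩ := Submodule.mem_sup.1 hw
  obtain ⟨r', rfl⟩ := Submodule.mem_span_singleton.1 hr'
  apply Submodule.mem_sup_right
  rw [FVF.add_lie, FVF.lie_add, FVF.lie_add, FVF.smul_lie, FVF.smul_lie, FVF.lie_smul, FVF.lie_smul,
    FVF.lie_self, smul_zero, smul_zero, zero_add, FVF.lie_skew v, smul_neg]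
  exact Submodule.add_mem _ (Submodule.smul_mem _ _ (lie_linear_mem_nonlinearClosure hw'))
    (Submodule.add_mem _ (Submodule.neg_mem _ (Submodule.smul_mem _ _
      (lie_linear_mem_nonlinearClosure hv'))) (lie_mem_nonlinearClosure hv' hw'))

end TripleZero
end

theorem theorem2p8 :
    (∃ L : LieSubalgebra ℝ TripleZero.FVF, L.toSubmodule = TripleZero.scriptB) ∧
    ∀ q₁ q₂ s₁ s₂ r₁ r₂ i₁ i₂ k₁ k₂ : ℤ,
      0 ≤ i₁ → 0 ≤ i₂ → 0 ≤ k₁ → 0 ≤ k₂ →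
      -1 ≤ q₁ → q₁ ≤ 2 * i₁ + 1 → -1 ≤ q₂ → q₂ ≤ 2 * i₂ + 1 →
      q₁ = 2 * s₁ + r₁ → (r₁ = 0 ∨ r₁ = 1) → q₂ = 2 * s₂ + r₂ → (r₂ = 0 ∨ r₂ = 1) →
      ⁅TripleZero.B q₁ i₁ k₁, TripleZero.B q₂ i₂ k₂⁆ =
        ∑ j ∈ Finset.Icc (max (TripleZero.sigma2 q₁ q₂ i₁ i₂ - 1) (-1))
            (s₁ + s₂ + (r₁ + r₂) / 2),
          TripleZero.a q₁ q₂ j i₁ i₂ •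
            TripleZero.B (2 * j + |r₂ - r₁|)
              (2 * j - TripleZero.sigma2 q₁ q₂ i₁ i₂ + |r₂ - r₁|)
              (TripleZero.sigma1 s₁ s₂ k₁ k₂ - j + (r₁ + r₂) / 2) :=
  ⟨⟨{ TripleZero.scriptB with lie_mem' := fun hv hw => TripleZero.lie_mem_scriptB hv hw }, rfl⟩,
    fun _ _ _ _ _ _ _ _ _ _ hi₁ hi₂ hk₁ hk₂ h₁ h₁' h₂ h₂' hq₁ hr₁ hq₂ hr₂ =>
      TripleZero.lie_B_eq_sum_Icc hi₁ hi₂ hk₁ hk₂ h₁ h₁' h₂ h₂' hq₁ hr₁ hq₂ hr₂⟩
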